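/- Let $M\cong\mathbb{Z}^n$ be a lattice, let $P\subset M_{\mathbb{R}}$ be a full-dimensional lattice polytope, and let $X=X_P$ be the projective toric variety of the inner normal fan of $P$, so that the cones of the fan correspond to the nonempty faces of $P$ and $\dim X=n$. Equip the set of real points $X(\mathbb{R})$ with the real analytic topology, and let $\mu:X(\mathbb{R})\to P$ be the moment map $$\mu(x)=\frac{\sum_{u\in P\cap M}|\chi^u(x)|\,u}{\sum_{u\in P\cap M}|\chi^u(x)|},$$ where the $\chi^u$, $u \in P\cap M$, are the sections of the ample line bundle on $X$ given by $P$. For a group homomorphism $\varepsilon:M\to\{\pm1\}$ let $X_\varepsilon\subset X(\mathbb{R})$ be the closure of $$T_\varepsilon=\{t\in T(\mathbb{R}) : \operatorname{sgn}\chi^u(t)=\varepsilon(u)\text{ for all }u\in M\},$$ where $T=\operatorname{Spec}\mathbb{R}[M]$ is the dense torus, and let $\mu_\varepsilon$ be the restriction of $\mu$ to $X_\varepsilon$. For a face $F$ of $P$, let $M_F$ be the subgroup of the elements of $M$ parallel to $F$ (that is, $M_F=\tau^\perp\cap M$ for the cone $\tau$ corresponding to $F$). Then the following hold. 1. For all group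 homomorphisms $\varepsilon,\varepsilon':M\to\{\pm1\}$, $$X_\varepsilon\cap X_{\varepsilon'}=\bigcup_{F:\ \varepsilon|_{M_F}=\varepsilon'|_{M_F}}\mu_\varepsilon^{-1}(F),$$ the union being over the faces $F$ of $P$ such that $\varepsilon$ and $\varepsilon'$ agree on $M_F$. 2. There are $2^{\dim X}$ group homomorphisms $\varepsilon:M\to\{\pm1\}$. Take one copy $P_\varepsilon$ of $P$ for each of them, with the face $F_\varepsilon$ of $P_\varepsilon$ corresponding to the face $F$ of $P$. Then $X(\mathbb{R})$ is homeomorphic to the quotient of $\bigsqcup_\varepsilon P_\varepsilon$ in which, for each face $F$ and all $\varepsilon,\varepsilon'$ with $\varepsilon|_{M_F}=\varepsilon'|_{M_F}$, every point of $F_\varepsilon$ is identified with the same point of $F_{\varepsilon'}$. The homeomorphism can be chosen so that the image in $X(\mathbb{R})$ of each point $p\in P_\varepsilon$ lies in $X_\varepsilon$ and is mapped to $p$ by $\mu_\varepsilon$. In this quotient, $F_\varepsilon$ is identified pointwise with $F_{\varepsilon'}$ if and only if $\varepsilon|_{M_F}=\varepsilon'|_{M_F}$. -/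

import Mathlib

namespace RealToric

/-- A full-dimensional lattice polytope `P` in `V = M_ℝ`: the convex hull of finitely many points of
the lattice `M`, with affine span the whole space. -/
structure LatticePolytope {V : Type*} [NormedAddCommGroup V] [NormedSpace ℝ V]
    (M : Submodule ℤ V) where
  carrier : Set V
  exists_eq_convexHull :
    ∃ A : Finset V, (A : Set V) ⊆ (M : Set V) ∧ carrier = convexHull ℝ (A : Set V)
  affineSpan_eq_top : affineSpan ℝ carrier = ⊤

/-- The group homomorphisms `M → {±1}`. -/
abbrev SignChar {V : Type*} [AddCommGroup V] (M : Submodule ℤ V) : Type _ :=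
  Multiplicative M →* ℤˣ

/-- The real points of the affine toric variety `Spec ℝ[S]`, i.e. the `ℝ`-algebra homomorphisms
`ℝ[S] → ℝ`. -/
def AffinePoints (S : Type*) [AddCommMonoid S] : Type _ :=
  AddMonoidAlgebra ℝ S →ₐ[ℝ] ℝ

namespace AffinePoints

variable {S S' : Type*} [AddCommMonoid S] [AddCommMonoid S']

/-- The value at the real point `x` of the regular function `f`. -/
noncomputable def eval (x : AffinePoints S) (f : AddMonoidAlgebra ℝ S) : ℝ :=
  (show AddMonoidAlgebra ℝ S →ₐ[ℝ] ℝ from x) f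

/-- The value at `x` of the character `χ^m`. -/
noncomputable def chi (x : AffinePoints S) (m : S) : ℝ :=
  x.eval (AddMonoidAlgebra.single m 1)

/-- The real analytic topology: the coarsest topology for which all regular functions are
continuous. -/
noncomputable instance : TopologicalSpace (AffinePoints S) :=
  TopologicalSpace.induced eval inferInstance

/-- The map on real points induced by a homomorphism of monoids `S → S'`. -/
noncomputable def comap (φ : S →+ S') (x : AffinePoints S') : AffinePoints S :=
  AlgHom.comp (show AddMonoidAlgebra ℝ S' →ₐ[ℝ] ℝ from x)
    (AddMonoidAlgebra.mapDomainAlgHom ℝ ℝ φ)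

theorem chi_comap (φ : S →+ S') (x : AffinePoints S') (m : S) :
    (x.comap φ).chi m = x.chi (φ m) := by
  simp only [chi, eval, comap]
  refine (AlgHom.comp_apply _ _ _).trans (congrArg _ ?_)
  simp

theorem chi_add (x : AffinePoints S) (m m' : S) : x.chi (m + m') = x.chi m * x.chi m' := by
  rw [chi, chi, chi, eval, eval, eval, ← map_mul, AddMonoidAlgebra.single_mul_single, one_mul]

theorem chi_zero (x : AffinePoints S) : x.chi 0 = 1 := by
  rw [chi, eval]
  exact map_one (show AddMonoidAlgebra ℝ S →ₐ[ℝ] ℝ from x)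

end AffinePoints

namespace LatticePolytope

variable {V : Type*} [NormedAddCommGroup V] [NormedSpace ℝ V] {M : Submodule ℤ V}

theorem convex (P : LatticePolytope M) : Convex ℝ P.carrier := by
  obtain ⟨A, -, h⟩ := P.exists_eq_convexHull
  rw [h]
  exact convex_convexHull ℝ _

theorem nonempty (P : LatticePolytope M) : P.carrier.Nonempty := by
  rw [← affineSpan_nonempty ℝ, P.affineSpan_eq_top]
  exact ⟨0, trivial⟩

/-- A (nonempty) face of `P`. -/
structure Face (P : LatticePolytope M) where
  carrier : Set V
  nonempty : carrier.Nonempty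
  isExposed : IsExposed ℝ P.carrier carrier

/-- `P` as a face of itself. -/
def top (P : LatticePolytope M) : P.Face where
  carrier := P.carrier
  nonempty := P.nonempty
  isExposed := IsExposed.refl P.carrier

namespace Face

variable {P : LatticePolytope M}

/-- The cone `σ_F ⊆ N_ℝ` of the inner normal fan of `P` that corresponds to the face `F`: the
functionals whose minimum on `P` is attained on all of `F`. -/
def normalCone (F : P.Face) : Set (Module.Dual ℝ V) :=
  {v | ∀ p ∈ F.carrier, ∀ q ∈ P.carrier, v p ≤ v q}

/-- The monoid `σ_F^∨ ∩ M`. -/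
def dualMonoid (F : P.Face) : AddSubmonoid M where
  carrier := {u | ∀ v ∈ F.normalCone, 0 ≤ v (u : V)}
  zero_mem' := by
    intro v _
    simp
  add_mem' := by
    intro a b ha hb v hv
    simpa using add_nonneg (ha v hv) (hb v hv)

/-- The subgroup `M_F` of the elements of `M` that are parallel to `F`. -/
def lattice (F : P.Face) : AddSubgroup M :=
  (vectorSpan ℝ F.carrier).toAddSubgroup.comap M.subtype.toAddMonoidHom

/-- If `F ⊆ G` then `σ_G` is a face of `σ_F`, and `σ_F^∨ ∩ M ⊆ σ_G^∨ ∩ M`. -/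
theorem dualMonoid_mono {F G : P.Face} (h : F.carrier ⊆ G.carrier) :
    F.dualMonoid ≤ G.dualMonoid :=
  fun _ hu v hv => hu v fun p hp q hq => hv p (h hp) q hq

theorem exists_latticePoint (F : P.Face) : ∃ u : M, (u : V) ∈ F.carrier := by
  obtain ⟨A, hA, hP⟩ := P.exists_eq_convexHull
  obtain ⟨l, hl⟩ := F.isExposed F.nonempty
  obtain ⟨x, hx⟩ := F.nonempty
  have hxP : x ∈ P.carrier := F.isExposed.subset hx
  have hx' := hx
  rw [hl] at hx'
  have hc : ConvexOn ℝ (convexHull ℝ (A : Set V)) l := l.toLinearMap.convexOn (convex_convexHull ℝ _)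
  obtain ⟨a, ha, hle⟩ := hc.exists_ge_of_mem_convexHull (subset_convexHull ℝ _) (hP ▸ hxP)
  refine ⟨⟨a, hA ha⟩, ?_⟩
  rw [hl]
  refine ⟨?_, fun y hy => (hx'.2 y hy).trans hle⟩
  rw [hP]
  exact subset_convexHull ℝ _ ha

/-- A lattice point of `F`. -/
noncomputable def base (F : P.Face) : M := F.exists_latticePoint.choose

theorem base_mem (F : P.Face) : (F.base : V) ∈ F.carrier := F.exists_latticePoint.choose_spec

/-- The real points `U_σ(ℝ)` of the affine chart `U_σ = Spec ℝ[σ^∨ ∩ M]`, for `σ = σ_F`. -/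
abbrev Chart (F : P.Face) : Type _ := AffinePoints F.dualMonoid

/-- The inclusion of `U_τ(ℝ)` into `U_σ(ℝ)` for the face `τ = σ_G` of `σ = σ_F`, where `F ⊆ G`. -/
noncomputable def incl {F G : P.Face} (h : F.carrier ⊆ G.carrier) : G.Chart → F.Chart :=
  AffinePoints.comap (AddSubmonoid.inclusion (dualMonoid_mono h))

end Face

/-- The real points of two affine charts `U_σ` and `U_σ'` are glued along `U_τ(ℝ)`, for the common
faces `τ` of `σ` and `σ'`. -/
def Glue (P : LatticePolytope M) (x y : Σ F : P.Face, F.Chart) : Prop :=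
  ∃ (G : P.Face) (hx : x.1.carrier ⊆ G.carrier) (hy : y.1.carrier ⊆ G.carrier) (z : G.Chart),
    Face.incl hx z = x.2 ∧ Face.incl hy z = y.2

/-- The set `X_P(ℝ)` of real points of the toric variety `X_P` of the inner normal fan of `P`,
glued from the real points of its affine charts. -/
def RealPoints (P : LatticePolytope M) : Type _ := Quot P.Glue

/-- The real analytic topology on `X_P(ℝ)`. -/
instance (P : LatticePolytope M) : TopologicalSpace P.RealPoints :=
  inferInstanceAs (TopologicalSpace (Quot P.Glue))

/-- The inclusion of the real points `T(ℝ)` of the torus `T = Spec ℝ[M]` into `X_P(ℝ)`, through the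
chart of the zero cone `σ_P`. -/
noncomputable def torusIncl (P : LatticePolytope M) (t : AffinePoints M) : P.RealPoints :=
  Quot.mk P.Glue ⟨P.top, t.comap P.top.dualMonoid.subtype⟩

/-- `T_ε`, as a subset of `X_P(ℝ)`. -/
def torusPart (P : LatticePolytope M) (ε : SignChar M) : Set P.RealPoints :=
  P.torusIncl '' {t | ∀ u : M,
    ((SignType.sign (t.chi u) : SignType) : ℤ) = (ε (Multiplicative.ofAdd u) : ℤ)}

/-- `X_ε`, the closure of `T_ε` in `X_P(ℝ)`. -/
def signPart (P : LatticePolytope M) (ε : SignChar M) : Set P.RealPoints :=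
  closure (P.torusPart ε)

/-- `P ∩ M` -/
def LatticePoint (P : LatticePolytope M) : Type _ := {u : M // (u : V) ∈ P.carrier}

theorem finite_latticePoint [FiniteDimensional ℝ V] [DiscreteTopology M]
    (P : LatticePolytope M) : Finite P.LatticePoint := by
  obtain ⟨A, -, hP⟩ := P.exists_eq_convexHull
  have hb : Bornology.IsBounded P.carrier := by
    rw [hP]
    exact (isBounded_convexHull).2 A.finite_toSet.isBounded
  have : DiscreteTopology M.toAddSubgroup := inferInstanceAs (DiscreteTopology M)
  have hM : IsClosed (M : Set V) := AddSubgroup.isClosed_of_discrete (H := M.toAddSubgroup)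
  have hd : IsDiscrete (M : Set V) := ⟨inferInstanceAs (DiscreteTopology M)⟩
  have hfin := Metric.finite_isBounded_inter_isClosed hd hb hM
  have : Finite ↥(P.carrier ∩ (M : Set V)) := hfin
  exact Finite.of_injective
    (fun u : P.LatticePoint => (⟨(u.1 : V), u.2, u.1.2⟩ : ↥(P.carrier ∩ (M : Set V))))
    fun a b h => Subtype.ext (Subtype.ext (congrArg (fun z : ↥(P.carrier ∩ (M : Set V)) => (z : V)) h))

noncomputable instance [FiniteDimensional ℝ V] [DiscreteTopology M] (P : LatticePolytope M) :
    Fintype P.LatticePoint :=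
  haveI := P.finite_latticePoint
  Fintype.ofFinite _

theorem sub_mem {P : LatticePolytope M} (F : P.Face) {u u₀ : M} (hu : (u : V) ∈ P.carrier)
    (h₀ : (u₀ : V) ∈ F.carrier) : u - u₀ ∈ F.dualMonoid := by
  intro v hv
  have := hv _ h₀ _ hu
  simpa using this

/-- On the chart of the face `F`, the line bundle of `P` is trivialised by `χ^{u₀}` for a lattice
point `u₀` of `F`; the section `χ^u` then becomes the function `χ^{u-u₀}`. This is its absolute
value. -/
noncomputable def weight {P : LatticePolytope M} (F : P.Face) (x : F.Chart)
    (u : P.LatticePoint) : ℝ :=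
  |x.chi ⟨u.1 - F.base, sub_mem F u.2 F.base_mem⟩|

/-- The moment map on the chart of the face `F`: the point
`(∑ |χ^u(x)| u) / (∑ |χ^u(x)|)`, with sums over `u ∈ P ∩ M`. -/
noncomputable def chartMoment [FiniteDimensional ℝ V] [DiscreteTopology M]
    {P : LatticePolytope M} (F : P.Face) (x : F.Chart) : V :=
  (∑ u : P.LatticePoint, weight F x u)⁻¹ • ∑ u : P.LatticePoint, weight F x u • ((u.1 : M) : V)

theorem sum_weight_pos [FiniteDimensional ℝ V] [DiscreteTopology M]
    {P : LatticePolytope M} (F : P.Face) (x : F.Chart) :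
    0 < ∑ u : P.LatticePoint, weight F x u := by
  refine Finset.sum_pos' (fun _ _ => abs_nonneg _)
    ⟨⟨F.base, F.isExposed.subset F.base_mem⟩, Finset.mem_univ _, ?_⟩
  have h : (⟨F.base - F.base, sub_mem F (F.isExposed.subset F.base_mem) F.base_mem⟩ :
      F.dualMonoid) = 0 := Subtype.ext (sub_self _)
  simp only [weight]
  rw [h, AffinePoints.chi_zero]
  norm_num

theorem chartMoment_mem [FiniteDimensional ℝ V] [DiscreteTopology M]
    {P : LatticePolytope M} (F : P.Face) (x : F.Chart) : chartMoment F x ∈ P.carrier :=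
  P.convex.centerMass_mem (t := Finset.univ) (w := weight F x)
    (z := fun u : P.LatticePoint => ((u.1 : M) : V)) (fun _ _ => abs_nonneg _)
    (sum_weight_pos F x) (fun u _ => u.2)

theorem chartMoment_incl [FiniteDimensional ℝ V] [DiscreteTopology M]
    {P : LatticePolytope M} {F G : P.Face} (h : F.carrier ⊆ G.carrier) (z : G.Chart) :
    chartMoment F (Face.incl h z) = chartMoment G z := by
  have hb : (F.base : V) ∈ G.carrier := h F.base_mem
  let c : G.dualMonoid := ⟨G.base - F.base, sub_mem G (G.isExposed.subset G.base_mem) hb⟩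
  let d : G.dualMonoid := ⟨F.base - G.base, sub_mem G (G.isExposed.subset hb) G.base_mem⟩
  have hcd : z.chi c * z.chi d = 1 := by
    rw [← AffinePoints.chi_add, ← AffinePoints.chi_zero z]
    congr 1
    apply Subtype.ext
    simp [c, d]
  have hc : |z.chi c| ≠ 0 := abs_ne_zero.2 (left_ne_zero_of_mul_eq_one hcd)
  have hw : ∀ u, weight F (Face.incl h z) u = |z.chi c| * weight G z u := by
    intro u
    rw [weight, weight, Face.incl, AffinePoints.chi_comap, ← abs_mul, ← AffinePoints.chi_add]
    congr 2
    apply Subtype.ext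
    simp [c]
  simp only [chartMoment, hw, mul_smul, ← Finset.mul_sum, ← Finset.smul_sum]
  rw [smul_smul, mul_inv_rev, mul_assoc, inv_mul_cancel₀ hc, mul_one]

/-- The moment map `μ : X_P(ℝ) → P`. -/
noncomputable def momentMap [FiniteDimensional ℝ V] [DiscreteTopology M]
    (P : LatticePolytope M) : P.RealPoints → P.carrier :=
  Quot.lift (fun x => ⟨chartMoment x.1 x.2, chartMoment_mem x.1 x.2⟩) (by
    rintro x y ⟨G, hx, hy, z, h1, h2⟩
    apply Subtype.ext
    change chartMoment x.1 x.2 = chartMoment y.1 y.2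
    rw [← h1, ← h2, chartMoment_incl, chartMoment_incl])

/-- `μ_ε`, the restriction of `μ` to `X_ε`. -/
noncomputable def signMomentMap [FiniteDimensional ℝ V] [DiscreteTopology M]
    (P : LatticePolytope M) (ε : SignChar M) : P.signPart ε → P.carrier :=
  (P.signPart ε).domRestrict P.momentMap

/-- `ε|_{M_F} = ε'|_{M_F}` -/
def Face.Agree {P : LatticePolytope M} (F : P.Face) (ε ε' : SignChar M) : Prop :=
  ∀ u ∈ F.lattice, ε (Multiplicative.ofAdd u) = ε' (Multiplicative.ofAdd u)

/-- The identification of points of the disjoint union of the copies `P_ε` of `P`: for each face `F`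
and all `ε`, `ε'` that agree on `M_F`, each point of `F_ε` is identified with the same point
of `F_ε'`. -/
def gluingSetoid (P : LatticePolytope M) : Setoid (Σ _ : SignChar M, P.carrier) where
  r a b := a.2 = b.2 ∧ ∃ F : P.Face, (a.2 : V) ∈ F.carrier ∧ F.Agree a.1 b.1
  iseqv :=
    { refl := fun a => ⟨rfl, P.top, a.2.2, fun _ _ => rfl⟩
      symm := by
        rintro a b ⟨h, F, hF, hag⟩
        exact ⟨h.symm, F, h ▸ hF, fun u hu => (hag u hu).symm⟩
      trans := by
        rintro a b c ⟨h, F, hF, hag⟩ ⟨h', F', hF', hag'⟩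
        have hF'' : (a.2 : V) ∈ F'.carrier := by
          rw [h]
          exact hF'
        refine ⟨h.trans h', ⟨F.carrier ∩ F'.carrier, ⟨_, hF, hF''⟩,
          F.isExposed.inter F'.isExposed⟩, ⟨hF, hF''⟩, fun u hu => ?_⟩
        exact (hag u (vectorSpan_mono ℝ Set.inter_subset_left hu)).trans
          (hag' u (vectorSpan_mono ℝ Set.inter_subset_right hu)) }

/-- The space constructed by gluing the copies `P_ε` of `P` along faces, with the quotient
topology. -/
abbrev GluedSpace (P : LatticePolytope M) : Type _ := Quotient P.gluingSetoid

/-- The point `p` of the copy `P_ε`, in the glued space. -/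
def GluedSpace.mk (P : LatticePolytope M) (ε : SignChar M) (p : P.carrier) : P.GluedSpace :=
  Quotient.mk P.gluingSetoid ⟨ε, p⟩

end LatticePolytope

end RealToric

/-!
The proof describes `X_P(ℝ)` by two continuous invariants of a real point, its moment and its signs.

*Weights.* A real point `x` has normalised weights `λ_u = |χ^u(x)| / ∑ |χ^w(x)|`, and its moment is
`∑ λ_u u`. The weight vectors that occur satisfy all binomial equations `∏ λ_u ^ a_u = ∏ λ_u ^ b_u`
with real exponents `a, b ≥ 0` of the same total and the same moment (`toricWeights`). If `λ`
and `λ'` satisfy these equations and have the same moment, then the equations with `a = λ` and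
`b = λ'` give `∑ (λ_u - λ'_u) (log λ_u - log λ'_u) = 0`, hence `λ = λ'`
(`toricWeights_injective`). Every `p` in `P` occurs as a moment: a minimiser of the convex function
`v ↦ ∑ exp (v (u - p))`, summed over the lattice points `u` of the smallest face `faceAt p` through
`p`, gives a point with moment `p` in the torus orbit of that face (`exists_critical`). The set of
toric weight vectors is compact, so the weights are continuous functions of the moment
(`continuous_weightAt`).

*Characters.* By Farkas' lemma every `m` in `σ_F^∨ ∩ M` is a nonnegative real combination of
differences `u - f` of lattice points of `P` with `f` in `F`, so `|χ^m(x)|` is a product of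
powers of ratios of weights (`abs_chi_eq_absChar`). A point `x` of a chart lies in the torus orbit
of `faceAt (μ x)`, where it has the form `ε · exp v` because `M_F` is a direct summand of `M`
(`exists_eq_incl_orbitPoint`). Consequently `x` is determined by its moment `p` and by signs `ε`
compatible with it, two choices of `ε` being equivalent exactly when they agree on the lattice of
`faceAt p`; and the resulting section `sectionPoint ε` of the moment map is continuous.

*Topology.* The points whose signs are compatible with `ε` form a closed set (`signSet`), which is
the image of `sectionPoint ε` and equals `X_ε`, since a point of an orbit is a limit of torus points
along a one-parameter subgroup (`signPart_eq_signSet`). The sections define a continuous bijection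
from the glued space to `X_P(ℝ)`. Its inverse is continuous because each chart is the union of
finitely many closed sets on which `ε` can be taken constant and the inverse is given by the moment
map (`gluedHomeomorph`); the Hausdorff property of `X_P(ℝ)` is not needed for this.
-/

/-! ### Farkas' lemma -/

namespace RealToric

/-- Farkas' lemma for finitely many linear functionals, in its algebraic form: if `m ≤ 0` follows
from the inequalities `b i ≤ 0`, then `m` is a nonnegative combination of the `b i`. The induction
eliminates one functional `b j` by projecting along a vector `v₀` that violates only the `j`-th
inequality. -/
theorem farkas_functional {W ι : Type*} [AddCommGroup W] [Module ℝ W] [DecidableEq ι]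
    (s : Finset ι) : ∀ (b : ι → Module.Dual ℝ W) (m : Module.Dual ℝ W),
    (∀ w, (∀ i ∈ s, b i w ≤ 0) → m w ≤ 0) →
      ∃ c : ι → ℝ, (∀ i, 0 ≤ c i) ∧ m = ∑ i ∈ s, c i • b i := by
  induction s using Finset.induction_on with
  | empty =>
    intro b m h
    refine ⟨0, fun _ => le_rfl, LinearMap.ext fun w => ?_⟩
    have h1 := h w (by simp)
    have h2 := h (-w) (by simp)
    simp only [map_neg] at h2
    simp only [Finset.sum_empty, LinearMap.zero_apply]
    linarith
  | insert j s hj ih =>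
    intro b m h
    by_cases hs : ∀ w, (∀ i ∈ s, b i w ≤ 0) → m w ≤ 0
    · obtain ⟨c, hc, hm⟩ := ih b m hs
      refine ⟨Function.update c j 0, fun i => ?_, ?_⟩
      · by_cases hi : i = j
        · subst hi; simp
        · simpa [hi] using hc i
      · rw [Finset.sum_insert hj, hm]
        simp only [Function.update_self, zero_smul, zero_add]
        refine Finset.sum_congr rfl fun i hi => ?_
        rw [Function.update_of_ne (ne_of_mem_of_not_mem hi hj)]
    · push Not at hs
      obtain ⟨w₁, hw₁, hm₁⟩ := hs
      have hj₁ : 0 < b j w₁ := by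
        by_contra hcon
        refine (h w₁ fun i hi => ?_).not_gt hm₁
        rcases Finset.mem_insert.1 hi with rfl | hi
        · exact not_lt.1 hcon
        · exact hw₁ i hi
      set w₀ := (b j w₁)⁻¹ • w₁ with hw₀
      have hj₀ : b j w₀ = 1 := by
        rw [hw₀, map_smul, smul_eq_mul, inv_mul_cancel₀ hj₁.ne']
      have hb₀ : ∀ i ∈ s, b i w₀ ≤ 0 := fun i hi => by
        rw [hw₀, map_smul, smul_eq_mul]
        exact mul_nonpos_of_nonneg_of_nonpos (inv_nonneg.2 hj₁.le) (hw₁ i hi)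
      have hm₀ : 0 ≤ m w₀ := by
        rw [hw₀, map_smul, smul_eq_mul]
        exact mul_nonneg (inv_nonneg.2 hj₁.le) hm₁.le
      obtain ⟨c, hc, hm⟩ := ih (fun i => b i - b i w₀ • b j) (m - m w₀ • b j) (by
        intro w hw
        have key := h (w - b j w • w₀) (by
          intro i hi
          rcases Finset.mem_insert.1 hi with rfl | hi
          · simp [hj₀]
          · have := hw i hi
            simp only [LinearMap.sub_apply, LinearMap.smul_apply, smul_eq_mul, map_sub,
              map_smul] at this ⊢
            linarith)
        simp only [LinearMap.sub_apply, LinearMap.smul_apply, smul_eq_mul, map_sub,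
          map_smul] at key ⊢
        linarith)
      have hd : 0 ≤ m w₀ - ∑ i ∈ s, c i * b i w₀ := by
        have : ∑ i ∈ s, c i * b i w₀ ≤ 0 :=
          Finset.sum_nonpos fun i hi => mul_nonpos_of_nonneg_of_nonpos (hc i) (hb₀ i hi)
        linarith
      refine ⟨Function.update c j (m w₀ - ∑ i ∈ s, c i * b i w₀), fun i => ?_, ?_⟩
      · by_cases hi : i = j
        · subst hi; simpa using hd
        · simpa [hi] using hc i
      · rw [Finset.sum_insert hj, Function.update_self]
        have hs' : ∑ i ∈ s, Function.update c j (m w₀ - ∑ i ∈ s, c i * b i w₀) i • b i =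
            ∑ i ∈ s, c i • b i := Finset.sum_congr rfl fun i hi => by
          rw [Function.update_of_ne (ne_of_mem_of_not_mem hi hj)]
        rw [hs']
        have hm' : m = m w₀ • b j + ∑ i ∈ s, c i • (b i - b i w₀ • b j) := by
          rw [← hm]; abel
        refine LinearMap.ext fun w => ?_
        refine (LinearMap.congr_fun hm' w).trans ?_
        simp only [LinearMap.add_apply, LinearMap.sub_apply, LinearMap.smul_apply,
          LinearMap.coe_sum, Finset.sum_apply, smul_eq_mul, mul_sub, Finset.sum_sub_distrib,
          ← mul_assoc, ← Finset.sum_mul, sub_mul]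
        ring

/-- Farkas' lemma: a vector on which every functional that is nonnegative on the `b i` is
nonnegative lies in the cone generated by the `b i`. -/
theorem farkas {V ι : Type*} [AddCommGroup V] [Module ℝ V] [Fintype ι] (b : ι → V) (m : V)
    (h : ∀ v : Module.Dual ℝ V, (∀ i, 0 ≤ v (b i)) → 0 ≤ v m) :
    ∃ c : ι → ℝ, (∀ i, 0 ≤ c i) ∧ m = ∑ i, c i • b i := by
  classical
  obtain ⟨c, hc, hm⟩ := farkas_functional Finset.univ
    (fun i => Module.Dual.eval ℝ V (b i)) (Module.Dual.eval ℝ V m) (by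
      intro w hw
      have := h (-w) (fun i => by simpa using hw i (Finset.mem_univ i))
      simpa using this)
  refine ⟨c, hc, Module.eval_apply_injective ℝ (V := V) ?_⟩
  rw [hm]
  simp

namespace LatticePolytope

variable {V : Type*} [NormedAddCommGroup V] [NormedSpace ℝ V] {M : Submodule ℤ V}
  {P : LatticePolytope M}

/-! ### Faces of a lattice polytope -/

/-- A lattice point of `P`, as a vector. -/
def LatticePoint.vec (u : P.LatticePoint) : V := (u.1 : V)

theorem LatticePoint.vec_mem (u : P.LatticePoint) : u.vec ∈ P.carrier := u.2

theorem carrier_eq_convexHull_range :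
    P.carrier = convexHull ℝ (Set.range (LatticePoint.vec (P := P))) := by
  apply Set.Subset.antisymm
  · obtain ⟨A, hA, hP⟩ := P.exists_eq_convexHull
    rw [hP]
    refine convexHull_mono fun a ha => ?_
    exact ⟨⟨⟨a, hA ha⟩, hP ▸ subset_convexHull ℝ _ ha⟩, rfl⟩
  · refine convexHull_min ?_ P.convex
    rintro _ ⟨u, rfl⟩
    exact u.vec_mem

section Finite

variable [FiniteDimensional ℝ V] [DiscreteTopology M]

theorem exists_weights {q : V} (hq : q ∈ P.carrier) :
    ∃ β : P.LatticePoint → ℝ, (∀ u, 0 ≤ β u) ∧ ∑ u, β u = 1 ∧ ∑ u, β u • u.vec = q := by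
  rw [carrier_eq_convexHull_range, convexHull_range_eq_exists_affineCombination] at hq
  obtain ⟨s, w, hw, hs, rfl⟩ := hq
  classical
  refine ⟨fun u => if u ∈ s then w u else 0, fun u => ?_, ?_, ?_⟩
  · dsimp only
    split_ifs with h
    · exact hw u h
    · exact le_rfl
  · simpa using hs
  · rw [s.affineCombination_eq_linear_combination _ _ hs]
    simp [ite_smul]

theorem sum_mem_carrier {β : P.LatticePoint → ℝ} (h0 : ∀ u, 0 ≤ β u) (h1 : ∑ u, β u = 1) :
    ∑ u, β u • u.vec ∈ P.carrier :=
  P.convex.sum_mem (fun u _ => h0 u) h1 fun u _ => u.vec_mem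

end Finite

namespace Face

variable {F G : P.Face}

theorem subset (F : P.Face) : F.carrier ⊆ P.carrier := F.isExposed.subset

theorem convex (F : P.Face) : Convex ℝ F.carrier := F.isExposed.convex P.convex

/-- A face is the set of points of `P` at which some functional of its normal cone is minimal. -/
theorem exists_functional (F : P.Face) : ∃ l ∈ F.normalCone,
    ∀ p ∈ F.carrier, ∀ q ∈ P.carrier, l q ≤ l p → q ∈ F.carrier := by
  obtain ⟨l, hl⟩ := F.isExposed F.nonempty
  refine ⟨-l.toLinearMap, fun p hp q hq => ?_, fun p hp q hq h => ?_⟩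
  · rw [hl] at hp
    simpa using hp.2 q hq
  · rw [hl] at hp ⊢
    have h' : l p ≤ l q := by simpa using h
    exact ⟨hq, fun y hy => (hp.2 y hy).trans h'⟩

/-- Faces are extreme: if a point of `F` lies on a segment in `P`, and is not its starting point,
then the end of the segment lies in `F`. -/
theorem mem_of_segment (F : P.Face) {p q x : V} (hq : q ∈ P.carrier) (hx : x ∈ P.carrier)
    {a b : ℝ} (ha : 0 ≤ a) (hb : 0 < b) (hab : a + b = 1) (hp : a • q + b • x = p)
    (hpF : p ∈ F.carrier) : x ∈ F.carrier := by
  obtain ⟨l, hl, hF⟩ := F.exists_functional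
  refine hF p hpF x hx ?_
  have h1 := hl p hpF q hq
  have h2 : l p = a * l q + b * l x := by rw [← hp]; simp
  have h3 : a * l p ≤ a * l q := mul_le_mul_of_nonneg_left h1 ha
  have h4 : a = 1 - b := by linarith
  have h5 : b * l x ≤ b * l p := by
    have : a * l p = l p - b * l p := by rw [h4]; ring
    linarith
  exact le_of_mul_le_mul_left h5 hb

theorem sub_mem_lattice (F : P.Face) {u u₀ : M} (hu : (u : V) ∈ F.carrier)
    (hu₀ : (u₀ : V) ∈ F.carrier) : u - u₀ ∈ F.lattice := by
  change ((u - u₀ : M) : V) ∈ vectorSpan ℝ F.carrier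
  simpa using vsub_mem_vectorSpan ℝ hu hu₀

theorem mem_lattice {F : P.Face} {m : M} : m ∈ F.lattice ↔ (m : V) ∈ vectorSpan ℝ F.carrier :=
  Iff.rfl

theorem lattice_mono (h : F.carrier ⊆ G.carrier) : F.lattice ≤ G.lattice :=
  fun _ hm => vectorSpan_mono ℝ h hm

/-- A functional that is constant on a face vanishes on the directions of the face. -/
theorem eq_zero_of_mem_vectorSpan {s : Set V} {l : Module.Dual ℝ V}
    (hl : ∀ p ∈ s, ∀ q ∈ s, l p = l q) {m : V} (hm : m ∈ vectorSpan ℝ s) : l m = 0 := by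
  have : vectorSpan ℝ s ≤ LinearMap.ker l := by
    rw [vectorSpan, Submodule.span_le]
    rintro _ ⟨p, hp, q, hq, rfl⟩
    simp [hl p hp q hq]
  exact this hm

theorem normalCone_eq_zero {l : Module.Dual ℝ V} (hl : l ∈ F.normalCone) {m : M}
    (hm : m ∈ F.lattice) : l m = 0 :=
  eq_zero_of_mem_vectorSpan (fun p hp q hq => le_antisymm (hl p hp q (F.subset hq))
    (hl q hq p (F.subset hp))) hm

theorem lattice_le_dualMonoid {m : M} (hm : m ∈ F.lattice) : m ∈ F.dualMonoid :=
  fun _ hv => (normalCone_eq_zero hv hm).ge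

/-- The intersection of two faces that meet. -/
def inter (F G : P.Face) (h : (F.carrier ∩ G.carrier).Nonempty) : P.Face where
  carrier := F.carrier ∩ G.carrier
  nonempty := h
  isExposed := F.isExposed.inter G.isExposed

end Face

section Finite

variable [FiniteDimensional ℝ V] [DiscreteTopology M]

namespace Face

variable {F G : P.Face}

/-- The face of `P` on which the functional `v` is minimal, given one of its points `p`. -/
def ofFunctional (v : Module.Dual ℝ V) {p : V} (hp : p ∈ P.carrier)
    (hv : ∀ q ∈ P.carrier, v p ≤ v q) : P.Face where
  carrier := {q | q ∈ P.carrier ∧ v q = v p}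
  nonempty := ⟨p, hp, rfl⟩
  isExposed := by
    intro _
    refine ⟨-LinearMap.toContinuousLinearMap v, Set.ext fun q => ?_⟩
    constructor
    · rintro ⟨hq, h⟩
      exact ⟨hq, fun y hy => by simpa [h] using hv y hy⟩
    · rintro ⟨hq, h⟩
      exact ⟨hq, le_antisymm (by simpa using h p hp) (hv q hq)⟩

/-- The lattice points that occur in a convex combination lying in a face lie in that face. -/
theorem mem_of_weights (F : P.Face) {β : P.LatticePoint → ℝ} (h0 : ∀ u, 0 ≤ β u)
    (h1 : ∑ u, β u = 1) (hp : ∑ u, β u • u.vec ∈ F.carrier) {u : P.LatticePoint}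
    (hu : β u ≠ 0) : u.vec ∈ F.carrier := by
  obtain ⟨l, hl, hF⟩ := F.exists_functional
  refine hF _ hp _ u.vec_mem ?_
  set p := ∑ u, β u • u.vec with hpdef
  have hsum : ∑ w, β w * (l w.vec - l p) = 0 := by
    have : l p = ∑ w, β w * l w.vec := by
      conv_lhs => rw [hpdef]
      simp
    simp only [mul_sub, Finset.sum_sub_distrib, ← Finset.sum_mul, h1]
    linarith
  have hz := (Finset.sum_eq_zero_iff_of_nonneg (fun w _ => mul_nonneg (h0 w)
    (sub_nonneg.2 (hl p hp _ w.vec_mem)))).1 hsum u (Finset.mem_univ u)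
  have := (mul_eq_zero.1 hz).resolve_left hu
  linarith

theorem subset_of_latticePoint (h : ∀ u : P.LatticePoint, u.vec ∈ F.carrier → u.vec ∈ G.carrier) :
    F.carrier ⊆ G.carrier := by
  intro x hx
  obtain ⟨β, h0, h1, rfl⟩ := exists_weights (F.subset hx)
  classical
  rw [← Finset.sum_filter_of_ne (p := fun u => β u ≠ 0) (by
    intro u _ hu h
    exact hu (by rw [h, zero_smul]))]
  refine G.convex.sum_mem (fun u _ => h0 u) ?_ fun u hu => ?_
  · rw [Finset.sum_filter_of_ne (fun u _ hu => hu), h1]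
  · exact h u (F.mem_of_weights h0 h1 hx (Finset.mem_filter.1 hu).2)

/-- The cone dual to the normal cone of `F` is generated by the differences `u - f` of lattice
points with `f` in `F`. -/
theorem exists_conic (F : P.Face) (m : F.dualMonoid) :
    ∃ c : P.LatticePoint × P.LatticePoint → ℝ, (∀ i, 0 ≤ c i) ∧
      (∀ i, c i ≠ 0 → i.2.vec ∈ F.carrier) ∧
      ((m : M) : V) = ∑ i, c i • (i.1.vec - i.2.vec) := by
  classical
  obtain ⟨c, hc, hm⟩ := farkas (fun i : {i : P.LatticePoint × P.LatticePoint //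
    i.2.vec ∈ F.carrier} => i.1.1.vec - i.1.2.vec) ((m : M) : V) (by
      intro v hv
      refine m.2 v fun p hp q hq => ?_
      obtain ⟨β, h0, h1, rfl⟩ := exists_weights (F.subset hp)
      obtain ⟨γ, g0, g1, rfl⟩ := exists_weights hq
      -- the double sum compares every lattice point of `F` with every lattice point of `P`
      have : v (∑ u, γ u • u.vec) - v (∑ u, β u • u.vec) =
          ∑ u, ∑ w, β u * (γ w * (v w.vec - v u.vec)) := by
        simp only [mul_sub, Finset.sum_sub_distrib, ← Finset.mul_sum, ← Finset.sum_mul, g1, h1,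
          map_sum, map_smul, smul_eq_mul, one_mul]
      rw [← sub_nonneg, this]
      refine Finset.sum_nonneg fun u _ => Finset.sum_nonneg fun w _ => ?_
      by_cases hu : β u = 0
      · simp [hu]
      · refine mul_nonneg (h0 u) (mul_nonneg (g0 w) ?_)
        simpa using hv ⟨(w, u), F.mem_of_weights h0 h1 hp hu⟩)
  refine ⟨fun i => if h : i.2.vec ∈ F.carrier then c ⟨i, h⟩ else 0, fun i => ?_, fun i hi => ?_, ?_⟩
  · dsimp only
    split_ifs
    · exact hc _
    · exact le_rfl
  · by_contra h
    exact hi (dif_neg h)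
  · refine hm.trans (Eq.symm ?_)
    rw [← Finset.sum_filter_of_ne (p := fun i => i.2.vec ∈ F.carrier)]
    · rw [Finset.sum_subtype _ (p := fun i => i.2.vec ∈ F.carrier) (by simp)]
      exact Finset.sum_congr rfl fun i _ => by
        dsimp only
        rw [dif_pos i.2]
    · intro i _ hi
      by_contra h
      exact hi (by dsimp only; rw [dif_neg h, zero_smul])

end Face

/-! ### The smallest face through a point -/

/-- There is a face through `p` that contains `p` in its relative interior: a face through `p` with
as few lattice points as possible. All functionals that are minimal at `p` are constant on it, so
by Farkas' lemma the vectors `p - u`, for `u` in the face, point from `p` into `P`. -/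
theorem exists_faceAt (p : P.carrier) : ∃ K : P.Face, (p : V) ∈ K.carrier ∧
    ∀ u ∈ K.carrier, ∃ δ : ℝ, 0 < δ ∧ (p : V) + δ • ((p : V) - u) ∈ P.carrier := by
  classical
  let n : P.Face → ℕ := fun K => (Finset.univ.filter fun u : P.LatticePoint =>
    u.vec ∈ K.carrier).card
  obtain ⟨K, hK⟩ : ∃ K, MinimalFor (fun K : P.Face => (p : V) ∈ K.carrier) n K :=
    exists_minimalFor_of_wellFoundedLT _ _ ⟨P.top, p.2⟩
  have hmin : ∀ v : Module.Dual ℝ V, (∀ q ∈ P.carrier, v p ≤ v q) → ∀ u ∈ K.carrier,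
      v u = v p := by
    intro v hv u hu
    let G := Face.ofFunctional v p.2 hv
    let H := K.inter G ⟨p, hK.1, p.2, rfl⟩
    have hHK : (Finset.univ.filter fun u : P.LatticePoint => u.vec ∈ H.carrier) ⊆
        Finset.univ.filter fun u : P.LatticePoint => u.vec ∈ K.carrier := fun u hu => by
      simp only [Finset.mem_filter, Finset.mem_univ, true_and] at hu ⊢
      exact hu.1
    have heq := Finset.eq_of_subset_of_card_le hHK
      (hK.2 (j := H) ⟨hK.1, p.2, rfl⟩ (Finset.card_le_card hHK))
    have : K.carrier ⊆ H.carrier := Face.subset_of_latticePoint fun w hw => by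
      have : w ∈ Finset.univ.filter fun u : P.LatticePoint => u.vec ∈ K.carrier := by
        simpa using hw
      rw [← heq] at this
      simpa using this
    exact (this hu).2.2
  refine ⟨K, hK.1, fun u hu => ?_⟩
  obtain ⟨c, hc, hsum⟩ := farkas (fun w : P.LatticePoint => w.vec - (p : V)) ((p : V) - u) (by
    intro v hv
    have hv' : ∀ q ∈ P.carrier, v p ≤ v q := by
      intro q hq
      obtain ⟨β, h0, h1, rfl⟩ := exists_weights hq
      have : v (∑ u, β u • u.vec) - v p = ∑ u, β u * v (u.vec - (p : V)) := by
        simp [mul_sub, Finset.sum_sub_distrib, ← Finset.sum_mul, h1]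
      rw [← sub_nonneg, this]
      exact Finset.sum_nonneg fun w _ => mul_nonneg (h0 w) (hv w)
    rw [map_sub, hmin v hv' u hu, sub_self])
  set C := ∑ w, c w with hC
  have hC0 : 0 ≤ C := Finset.sum_nonneg fun w _ => hc w
  refine ⟨(1 + C)⁻¹, by positivity, ?_⟩
  have hq : (p : V) + (1 + C)⁻¹ • ((p : V) - u) =
      (1 + C)⁻¹ • (p : V) + ∑ w, ((1 + C)⁻¹ * c w) • w.vec := by
    rw [hsum]
    simp only [smul_sub, Finset.sum_sub_distrib, ← Finset.sum_smul, ← hC, mul_smul,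
      ← Finset.smul_sum]
    have h1 : (p : V) = (1 + C)⁻¹ • (p : V) + (1 + C)⁻¹ • C • (p : V) := by
      rw [← smul_add]
      nth_rewrite 2 [← one_smul ℝ (p : V)]
      rw [← add_smul, smul_smul, inv_mul_cancel₀ (by positivity), one_smul]
    nth_rewrite 1 [h1]
    abel
  rw [hq]
  obtain ⟨β, h0, h1, hβ⟩ := exists_weights p.2
  have hsum' : (1 + C)⁻¹ • (p : V) + ∑ w, ((1 + C)⁻¹ * c w) • w.vec =
      ∑ w, ((1 + C)⁻¹ * (β w + c w)) • w.vec := by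
    simp only [mul_add, add_smul, Finset.sum_add_distrib, mul_smul, ← Finset.smul_sum]
    rw [hβ]
  rw [hsum']
  refine sum_mem_carrier (fun w => mul_nonneg (by positivity) (add_nonneg (h0 w) (hc w))) ?_
  rw [← Finset.mul_sum, Finset.sum_add_distrib, h1, ← hC, inv_mul_cancel₀ (by positivity)]

/-- The smallest face of `P` that contains `p`. -/
noncomputable def faceAt (p : P.carrier) : P.Face := (exists_faceAt p).choose

theorem mem_faceAt (p : P.carrier) : (p : V) ∈ (faceAt p).carrier :=
  (exists_faceAt p).choose_spec.1

theorem faceAt_subset {p : P.carrier} {F : P.Face} (h : (p : V) ∈ F.carrier) :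
    (faceAt p).carrier ⊆ F.carrier := by
  intro u hu
  obtain ⟨δ, hδ, hq⟩ := (exists_faceAt p).choose_spec.2 u hu
  refine F.mem_of_segment hq ((faceAt p).subset hu) (a := (1 + δ)⁻¹) (b := (1 + δ)⁻¹ * δ)
    (by positivity) (by positivity) (by field_simp) ?_ h
  rw [mul_smul, ← smul_add]
  have : (p : V) + δ • ((p : V) - u) + δ • u = (1 + δ) • (p : V) := by
    rw [smul_sub, add_smul, one_smul]; abel
  rw [this, smul_smul, inv_mul_cancel₀ (by positivity), one_smul]

/-- `p` lies in the relative interior of the smallest face that contains it. -/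
theorem exists_add_smul_mem (p : P.carrier) {m : V}
    (hm : m ∈ vectorSpan ℝ (faceAt p).carrier) :
    ∃ δ : ℝ, 0 < δ ∧ ∀ t : ℝ, |t| ≤ δ → (p : V) + t • m ∈ P.carrier := by
  rw [vectorSpan_eq_span_vsub_set_right ℝ (mem_faceAt p)] at hm
  induction hm using Submodule.span_induction with
  | mem x hx =>
    obtain ⟨u, hu, rfl⟩ := hx
    obtain ⟨δ, hδ, hq⟩ := (exists_faceAt p).choose_spec.2 u hu
    refine ⟨min δ 1, by positivity, fun t ht => ?_⟩
    have ht1 := abs_le.1 (ht.trans (min_le_right _ _))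
    have ht2 := abs_le.1 (ht.trans (min_le_left _ _))
    rcases le_total 0 t with h | h
    · exact P.convex.add_smul_mem p.2 (by simpa using (faceAt p).subset hu) ⟨h, ht1.2⟩
    · have := P.convex.add_smul_mem p.2 hq (t := -t / δ)
        ⟨div_nonneg (by linarith) hδ.le, (div_le_one hδ).2 (by linarith)⟩
      rwa [smul_smul, div_mul_cancel₀ _ hδ.ne', neg_smul, ← smul_neg, neg_sub] at this
  | zero => exact ⟨1, one_pos, fun t _ => by simp⟩
  | add x y _ _ hx hy =>
    obtain ⟨δ, hδ, hx⟩ := hx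
    obtain ⟨δ', hδ', hy⟩ := hy
    refine ⟨min δ δ' / 2, by positivity, fun t ht => ?_⟩
    have h2 : |2 * t| ≤ min δ δ' := by
      rw [abs_mul, abs_two]
      linarith
    have := P.convex (hx _ (h2.trans (min_le_left _ _))) (hy _ (h2.trans (min_le_right _ _)))
      (a := 1 / 2) (b := 1 / 2) (by norm_num) (by norm_num) (by norm_num)
    convert this using 1
    module
  | smul a x _ hx =>
    obtain ⟨δ, hδ, hx⟩ := hx
    refine ⟨δ / (|a| + 1), by positivity, fun t ht => ?_⟩
    rw [smul_smul]
    refine hx _ ?_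
    rw [abs_mul]
    rw [le_div_iff₀ (by positivity)] at ht
    nlinarith [abs_nonneg t, abs_nonneg a]

end Finite
end LatticePolytope

/-! ### Real points of affine charts as characters -/

namespace AffinePoints

variable {S : Type*} [AddCommMonoid S]

theorem eval_eq_sum (x : AffinePoints S) (f : AddMonoidAlgebra ℝ S) :
    x.eval f = f.coeff.sum fun m r => r * x.chi m := by
  let X : AddMonoidAlgebra ℝ S →ₐ[ℝ] ℝ := x
  have h : X = AddMonoidAlgebra.lift ℝ ℝ S
      (X.toMonoidHom.comp (AddMonoidAlgebra.of ℝ S)) := by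
    refine AddMonoidAlgebra.algHom_ext (fun m => ?_) (Subsingleton.elim _ _)
    simp
  change X f = _
  rw [h, AddMonoidAlgebra.lift_apply]
  rfl

theorem ext_chi {x y : AffinePoints S} (h : ∀ m, x.chi m = y.chi m) : x = y :=
  AddMonoidAlgebra.algHom_ext (φ₁ := (show AddMonoidAlgebra ℝ S →ₐ[ℝ] ℝ from x))
    (φ₂ := (show AddMonoidAlgebra ℝ S →ₐ[ℝ] ℝ from y)) h
    (Subsingleton.elim _ _)

/-- The real point given by a multiplicative function `S → ℝ`. -/
noncomputable def ofChar (φ : Multiplicative S →* ℝ) : AffinePoints S :=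
  AddMonoidAlgebra.lift ℝ ℝ S φ

theorem chi_ofChar (φ : Multiplicative S →* ℝ) (m : S) :
    (ofChar φ).chi m = φ (Multiplicative.ofAdd m) := by
  refine (AddMonoidAlgebra.lift_single φ m (1 : ℝ)).trans ?_
  simp

theorem continuous_chi (m : S) : Continuous fun x : AffinePoints S => x.chi m :=
  (continuous_apply (AddMonoidAlgebra.single m (1 : ℝ))).comp continuous_induced_dom

/-- A filter converges to a real point as soon as all characters converge. -/
theorem tendsto_nhds {Y : Type*} {l : Filter Y} {g : Y → AffinePoints S} {x : AffinePoints S}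
    (h : ∀ m, Filter.Tendsto (fun y => (g y).chi m) l (nhds (x.chi m))) :
    Filter.Tendsto g l (nhds x) := by
  rw [nhds_induced, Filter.tendsto_comap_iff, tendsto_pi_nhds]
  intro f
  simp only [Function.comp_def, eval_eq_sum, Finsupp.sum]
  exact tendsto_finsetSum _ fun m _ => (h m).const_mul _

theorem chi_sum {ι : Type*} (x : AffinePoints S) (s : Finset ι) (f : ι → S) :
    x.chi (∑ i ∈ s, f i) = ∏ i ∈ s, x.chi (f i) := by
  classical
  induction s using Finset.induction_on with
  | empty => simpa using x.chi_zero
  | insert a s ha ih => rw [Finset.sum_insert ha, chi_add, ih, Finset.prod_insert ha]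

theorem chi_nsmul (x : AffinePoints S) (n : ℕ) (m : S) : x.chi (n • m) = x.chi m ^ n := by
  simpa using x.chi_sum (Finset.range n) fun _ => m

end AffinePoints

namespace SignChar

variable {V : Type*} [AddCommGroup V] {M : Submodule ℤ V}

/-- The value of a sign character, as a real number. -/
def val (ε : SignChar M) (m : M) : ℝ := ((ε (Multiplicative.ofAdd m) : ℤ) : ℝ)

theorem val_add (ε : SignChar M) (m m' : M) : ε.val (m + m') = ε.val m * ε.val m' := by
  simp [val]

theorem val_zero (ε : SignChar M) : ε.val 0 = 1 := by
  simp [val]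

theorem val_eq (ε : SignChar M) (m : M) : ε.val m = 1 ∨ ε.val m = -1 := by
  rcases Int.units_eq_one_or (ε (Multiplicative.ofAdd m)) with h | h <;> simp [val, h]

theorem abs_val (ε : SignChar M) (m : M) : |ε.val m| = 1 := by
  rcases ε.val_eq m with h | h <;> simp [h]

theorem val_inj {ε ε' : SignChar M} {m m' : M} : ε.val m = ε'.val m' ↔
    ε (Multiplicative.ofAdd m) = ε' (Multiplicative.ofAdd m') := by
  simp [val, Units.ext_iff]

end SignChar

namespace LatticePolytope

variable {V : Type*} [NormedAddCommGroup V] [NormedSpace ℝ V] {M : Submodule ℤ V}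
  {P : LatticePolytope M}

namespace Face

variable {F G : P.Face}

theorem chi_incl (h : F.carrier ⊆ G.carrier) (z : G.Chart) (m : F.dualMonoid) :
    (incl h z).chi m = z.chi ⟨m, dualMonoid_mono h m.2⟩ :=
  AffinePoints.chi_comap _ _ _

theorem chi_ne_zero_of_mem_lattice (x : F.Chart) {m : F.dualMonoid} (hm : (m : M) ∈ F.lattice) :
    x.chi m ≠ 0 := by
  have h : x.chi m * x.chi ⟨-m, lattice_le_dualMonoid (neg_mem hm)⟩ = 1 := by
    rw [← AffinePoints.chi_add, ← x.chi_zero]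
    congr 1
    apply Subtype.ext
    simp
  exact left_ne_zero_of_mul_eq_one h

open Classical in
/-- The function `ε · exp v` on `M_F`, extended by zero. -/
noncomputable def orbitChar (F : P.Face) (ε : SignChar M) (v : Module.Dual ℝ V)
    (m : F.dualMonoid) : ℝ :=
  if (m : M) ∈ F.lattice then ε.val m * Real.exp (v (m : M)) else 0

theorem orbitChar_zero (F : P.Face) (ε : SignChar M) (v : Module.Dual ℝ V) :
    F.orbitChar ε v 0 = 1 := by
  rw [orbitChar, if_pos (by simp)]
  simp [SignChar.val_zero]

end Face

section Finite

variable [FiniteDimensional ℝ V] [DiscreteTopology M]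

/-! ### Torus orbits -/

namespace Face

variable {F G : P.Face}

/-- An element of `σ_F^∨ ∩ M` on which a functional in the relative interior of `σ_F` vanishes is
parallel to `F`. -/
theorem mem_lattice_of_functional {l : Module.Dual ℝ V} (hl : l ∈ F.normalCone)
    (hF : ∀ p ∈ F.carrier, ∀ q ∈ P.carrier, l q ≤ l p → q ∈ F.carrier) {m : M}
    (hm : m ∈ F.dualMonoid) (h0 : l m ≤ 0) : m ∈ F.lattice := by
  obtain ⟨c, hc, hcF, hsum⟩ := F.exists_conic ⟨m, hm⟩
  have hnn : ∀ i, 0 ≤ c i * (l i.1.vec - l i.2.vec) := fun i => by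
    by_cases hi : c i = 0
    · simp [hi]
    · exact mul_nonneg (hc i) (sub_nonneg.2 (hl _ (hcF i hi) _ i.1.vec_mem))
  have hlm : l m = ∑ i, c i * (l i.1.vec - l i.2.vec) := by
    simp only at hsum
    rw [hsum]
    simp
  have hz := (Finset.sum_eq_zero_iff_of_nonneg (fun i _ => hnn i)).1
    (le_antisymm (hlm ▸ h0) (Finset.sum_nonneg fun i _ => hnn i))
  rw [mem_lattice]
  simp only at hsum
  rw [hsum]
  refine Submodule.sum_mem _ fun i _ => ?_
  by_cases hi : c i = 0
  · simp [hi]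
  · refine Submodule.smul_mem _ _ (vsub_mem_vectorSpan ℝ ?_ (hcF i hi))
    refine hF _ (hcF i hi) _ i.1.vec_mem ?_
    have := (mul_eq_zero.1 (hz i (Finset.mem_univ i))).resolve_left hi
    linarith

/-- `M_F` is a face of the monoid `σ_F^∨ ∩ M`. -/
theorem mem_lattice_of_add {m m' : M} (hm : m ∈ F.dualMonoid) (hm' : m' ∈ F.dualMonoid)
    (h : m + m' ∈ F.lattice) : m ∈ F.lattice := by
  obtain ⟨l, hl, hF⟩ := F.exists_functional
  refine mem_lattice_of_functional hl hF hm ?_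
  have h0 := normalCone_eq_zero hl h
  have h1 := hm' l hl
  simp only [Submodule.coe_add, map_add] at h0
  linarith

theorem add_mem_lattice_iff {m m' : M} (hm : m ∈ F.dualMonoid) (hm' : m' ∈ F.dualMonoid) :
    m + m' ∈ F.lattice ↔ m ∈ F.lattice ∧ m' ∈ F.lattice :=
  ⟨fun h => ⟨mem_lattice_of_add hm hm' h, mem_lattice_of_add hm' hm (add_comm m m' ▸ h)⟩,
    fun h => add_mem h.1 h.2⟩

theorem orbitChar_add (F : P.Face) (ε : SignChar M) (v : Module.Dual ℝ V) (m m' : F.dualMonoid) :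
    F.orbitChar ε v (m + m') = F.orbitChar ε v m * F.orbitChar ε v m' := by
  have h := add_mem_lattice_iff m.2 m'.2
  simp only [orbitChar, AddSubmonoid.coe_add, Submodule.coe_add, map_add, Real.exp_add,
    SignChar.val_add]
  by_cases h1 : (m : M) ∈ F.lattice
  · by_cases h2 : (m' : M) ∈ F.lattice
    · rw [if_pos h1, if_pos h2, if_pos (h.2 ⟨h1, h2⟩)]
      ring
    · rw [if_neg h2, if_neg fun h' => h2 (h.1 h').2, mul_zero]
  · rw [if_neg h1, if_neg fun h' => h1 (h.1 h').1, zero_mul]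

/-- The point of the torus orbit of `σ_F` with coordinates `ε · exp v`: the character `χ^m` is
`ε(m) exp (v m)` for `m` in `M_F`, and vanishes at the point for all other `m` in `σ_F^∨ ∩ M`. -/
noncomputable def orbitPoint (F : P.Face) (ε : SignChar M) (v : Module.Dual ℝ V) : F.Chart :=
  AffinePoints.ofChar
    { toFun := fun m => F.orbitChar ε v m.toAdd
      map_one' := F.orbitChar_zero ε v
      map_mul' := fun m m' => F.orbitChar_add ε v m.toAdd m'.toAdd }

theorem chi_orbitPoint {ε : SignChar M} {v : Module.Dual ℝ V} {m : F.dualMonoid}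
    (hm : (m : M) ∈ F.lattice) :
    (F.orbitPoint ε v).chi m = ε.val m * Real.exp (v (m : M)) := by
  rw [orbitPoint, AffinePoints.chi_ofChar]
  exact if_pos hm

theorem chi_orbitPoint_of_notMem {ε : SignChar M} {v : Module.Dual ℝ V} {m : F.dualMonoid}
    (hm : (m : M) ∉ F.lattice) : (F.orbitPoint ε v).chi m = 0 := by
  rw [orbitPoint, AffinePoints.chi_ofChar]
  exact if_neg hm

end Face

/-! ### Normalised weights -/

/-- The weights of the lattice points in the moment map, normalised to sum `1`. -/
noncomputable def normWeight (F : P.Face) (x : F.Chart) (u : P.LatticePoint) : ℝ :=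
  (∑ w : P.LatticePoint, weight F x w)⁻¹ * weight F x u

theorem normWeight_nonneg (F : P.Face) (x : F.Chart) (u : P.LatticePoint) :
    0 ≤ normWeight F x u :=
  mul_nonneg (inv_nonneg.2 (sum_weight_pos F x).le) (abs_nonneg _)

theorem sum_normWeight (F : P.Face) (x : F.Chart) : ∑ u, normWeight F x u = 1 := by
  simp only [normWeight, ← Finset.mul_sum]
  exact inv_mul_cancel₀ (sum_weight_pos F x).ne'

theorem sum_normWeight_smul (F : P.Face) (x : F.Chart) :
    ∑ u, normWeight F x u • u.vec = chartMoment F x := by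
  simp only [normWeight, mul_smul, ← Finset.smul_sum, chartMoment]
  rfl

theorem normWeight_ne_zero {F : P.Face} {x : F.Chart} {u : P.LatticePoint} :
    normWeight F x u ≠ 0 ↔ x.chi ⟨u.1 - F.base, sub_mem F u.2 F.base_mem⟩ ≠ 0 := by
  rw [normWeight, mul_ne_zero_iff, weight, abs_ne_zero]
  exact ⟨fun h => h.2, fun h => ⟨inv_ne_zero (sum_weight_pos F x).ne', h⟩⟩

/-- The image of a point of a chart under the moment map. -/
noncomputable def chartMu (F : P.Face) (x : F.Chart) : P.carrier :=
  ⟨chartMoment F x, chartMoment_mem F x⟩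

theorem mem_faceAt_of_normWeight_ne_zero {F : P.Face} {x : F.Chart} {u : P.LatticePoint}
    (hu : normWeight F x u ≠ 0) : u.vec ∈ (faceAt (chartMu F x)).carrier := by
  refine (faceAt (chartMu F x)).mem_of_weights (normWeight_nonneg F x) (sum_normWeight F x) ?_ hu
  rw [sum_normWeight_smul]
  exact mem_faceAt (chartMu F x)

theorem normWeight_ne_zero_of_mem {F : P.Face} {x : F.Chart} {u : P.LatticePoint}
    (hu : u.vec ∈ F.carrier) : normWeight F x u ≠ 0 :=
  normWeight_ne_zero.2 (Face.chi_ne_zero_of_mem_lattice x (F.sub_mem_lattice hu F.base_mem))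

theorem subset_faceAt_chartMu (F : P.Face) (x : F.Chart) :
    F.carrier ⊆ (faceAt (chartMu F x)).carrier :=
  Face.subset_of_latticePoint fun _ hu =>
    mem_faceAt_of_normWeight_ne_zero (normWeight_ne_zero_of_mem hu)

theorem chartMu_incl {F G : P.Face} (h : F.carrier ⊆ G.carrier) (z : G.Chart) :
    chartMu F (Face.incl h z) = chartMu G z :=
  Subtype.ext (chartMoment_incl h z)

/-! ### Extending characters from `M_F` to `M` -/

section Extension

variable [IsZLattice ℝ M]

/-- Additive functions on the lattice extend to linear functionals. -/
theorem exists_dual_of_addMonoidHom (g : M →+ ℝ) :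
    ∃ v : Module.Dual ℝ V, ∀ m : M, v m = g m := by
  have : Module.Free ℤ M := ZLattice.module_free ℝ M
  have : Module.Finite ℤ M := ZLattice.module_finite ℝ M
  let b := Module.Free.chooseBasis ℤ M
  let B := b.ofZLatticeBasis ℝ M
  let v : Module.Dual ℝ V := B.constr ℝ fun i => g (b i)
  have h : (v.restrictScalars ℤ).comp M.subtype = g.toIntLinearMap := b.ext fun i => by
    have : v (B i) = g (b i) := B.constr_basis ℝ _ i
    simpa [B] using this
  exact ⟨v, fun m => LinearMap.congr_fun h m⟩

/-- `M_F` is a direct summand of `M`. -/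
theorem Face.exists_projection (F : P.Face) :
    ∃ π : M →+ F.lattice, ∀ m : F.lattice, π m = m := by
  have : Module.Free ℤ M := ZLattice.module_free ℝ M
  have : Module.Finite ℤ M := ZLattice.module_finite ℝ M
  let L : Submodule ℤ M := AddSubgroup.toIntSubmodule F.lattice
  have htf : Module.IsTorsionFree ℤ (M ⧸ L) := by
    refine Module.IsTorsionFree.of_smul_eq_zero fun n x hx => or_iff_not_imp_left.2 fun hn => ?_
    obtain ⟨m, rfl⟩ := L.mkQ_surjective x
    rw [← map_smul] at hx
    refine (Submodule.Quotient.mk_eq_zero L).2 ?_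
    have h : (n : ℝ) • (m : V) ∈ vectorSpan ℝ F.carrier := by
      have h' : n • m ∈ F.lattice := (Submodule.Quotient.mk_eq_zero L).1 hx
      have := Face.mem_lattice.1 h'
      rwa [Submodule.coe_smul, ← Int.cast_smul_eq_zsmul ℝ] at this
    exact ((vectorSpan ℝ F.carrier).smul_mem_iff (Int.cast_ne_zero.2 hn)).1 h
  have : Module.Free ℤ (M ⧸ L) := inferInstance
  obtain ⟨s, hs⟩ := Module.projective_lifting_property L.mkQ LinearMap.id L.mkQ_surjective
  have hmem : ∀ m : M, m - s (L.mkQ m) ∈ L := fun m => by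
    refine (Submodule.Quotient.eq L).1 ?_
    exact (LinearMap.congr_fun hs (L.mkQ m)).symm
  refine ⟨{ toFun := fun m => ⟨m - s (L.mkQ m), hmem m⟩
            map_zero' := by simp
            map_add' := fun a b => Subtype.ext (by simp only [map_add, AddSubgroup.coe_add]; abel) },
    fun m => Subtype.ext ?_⟩
  have : L.mkQ (m : M) = 0 := (Submodule.Quotient.mk_eq_zero L).2 m.2
  change (m : M) - s (L.mkQ m) = m
  rw [this, map_zero, sub_zero]

/-- A real character of `M_F` extends to `M`, and is then the product of its sign and its absolute
value. -/
theorem Face.exists_sign_dual (F : P.Face) (g : Multiplicative F.lattice →* ℝˣ) :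
    ∃ (ε : SignChar M) (v : Module.Dual ℝ V), ∀ (m : M) (hm : m ∈ F.lattice),
      (g (Multiplicative.ofAdd ⟨m, hm⟩) : ℝ) = ε.val m * Real.exp (v m) := by
  obtain ⟨π, hπ⟩ := F.exists_projection
  let y : Multiplicative M →* ℝˣ := g.comp (AddMonoidHom.toMultiplicative π)
  let s : ℝˣ →* ℤˣ := Units.map
    ((SignType.castHom (α := ℤ)).toMonoidHom.comp (signHom (α := ℝ)).toMonoidHom)
  obtain ⟨v, hv⟩ := exists_dual_of_addMonoidHom (M := M)
    { toFun := fun m => Real.log (y (Multiplicative.ofAdd m) : ℝ)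
      map_zero' := by simp
      map_add' := fun a b => by
        rw [ofAdd_add, map_mul, Units.val_mul, Real.log_mul (Units.ne_zero _) (Units.ne_zero _)] }
  refine ⟨s.comp y, v, fun m hm => ?_⟩
  have hy : y (Multiplicative.ofAdd m) = g (Multiplicative.ofAdd ⟨m, hm⟩) :=
    congrArg (fun z => g (Multiplicative.ofAdd z)) (hπ ⟨m, hm⟩)
  rw [hv, ← hy]
  change _ = _ * Real.exp (Real.log _)
  have h0 : (y (Multiplicative.ofAdd m) : ℝ) ≠ 0 := Units.ne_zero _
  rw [Real.exp_log_eq_abs h0]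
  have hval : SignChar.val (s.comp y) m =
      ((SignType.sign (y (Multiplicative.ofAdd m) : ℝ) : SignType) : ℝ) := by
    simp [SignChar.val, s]
  rw [hval]
  rcases lt_or_gt_of_ne h0 with h | h
  · rw [sign_neg h, abs_of_neg h]; simp
  · rw [sign_pos h, abs_of_pos h]; simp

end Extension

/-! ### The orbit decomposition of a chart -/

open Classical in
/-- The sum of the elements `u - u₀` of `σ_F^∨ ∩ M`, for the base point `u₀` of `F` and the lattice
points `u` of `P` whose sections do not vanish at `x`. -/
noncomputable def supportSum (F : P.Face) (x : F.Chart) : F.dualMonoid :=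
  ∑ u ∈ Finset.univ.filter fun u => normWeight F x u ≠ 0,
    ⟨u.1 - F.base, sub_mem F u.2 F.base_mem⟩

theorem chi_supportSum_ne_zero (F : P.Face) (x : F.Chart) : x.chi (supportSum F x) ≠ 0 := by
  classical
  rw [supportSum, AffinePoints.chi_sum, Finset.prod_ne_zero_iff]
  intro u hu
  exact normWeight_ne_zero.1 (Finset.mem_filter.1 hu).2

theorem normWeight_le_one (F : P.Face) (x : F.Chart) (u : P.LatticePoint) :
    normWeight F x u ≤ 1 := by
  rw [← sum_normWeight F x]
  exact Finset.single_le_sum (fun w _ => normWeight_nonneg F x w) (Finset.mem_univ u)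

theorem le_supportSum (F : P.Face) (x : F.Chart) {v : Module.Dual ℝ V} (hv : v ∈ F.normalCone) :
    v (chartMoment F x) - v F.base ≤ v (supportSum F x : M) := by
  classical
  have h1 : v (chartMoment F x) - v F.base =
      ∑ u, normWeight F x u * (v u.vec - v F.base) := by
    simp only [mul_sub, Finset.sum_sub_distrib, ← Finset.sum_mul, sum_normWeight, one_mul]
    rw [← sum_normWeight_smul]
    simp
  have h2 : v (supportSum F x : M) =
      ∑ u ∈ Finset.univ.filter fun u => normWeight F x u ≠ 0, (v u.vec - v F.base) := by
    rw [supportSum, AddSubmonoid.coe_finsetSum, Submodule.coe_sum, map_sum]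
    simp [LatticePoint.vec]
  rw [h1, h2, ← Finset.sum_filter_of_ne (p := fun u => normWeight F x u ≠ 0)]
  · refine Finset.sum_le_sum fun u _ => ?_
    exact mul_le_of_le_one_left (sub_nonneg.2 (hv _ F.base_mem _ u.vec_mem))
      (normWeight_le_one F x u)
  · exact fun u _ hu => left_ne_zero_of_mul hu

/-- The sum of the support of `x` lies in the relative interior of a face of the cone dual to
`σ_F`, so it dominates every direction of that face. -/
theorem exists_nsmul_add_mem (F : P.Face) (x : F.Chart) {m : M}
    (hm : m ∈ (faceAt (chartMu F x)).lattice) :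
    ∃ N : ℕ, N • (supportSum F x : M) + m ∈ F.dualMonoid := by
  obtain ⟨δ, hδ, h⟩ := exists_add_smul_mem (chartMu F x) (Face.mem_lattice.1 hm)
  obtain ⟨N, hN⟩ := exists_nat_gt (1 / δ)
  refine ⟨N, fun v hv => ?_⟩
  have h1 := hv _ F.base_mem _ (h δ (abs_of_pos hδ).le)
  have h2 := le_supportSum F x hv
  have h3 := (supportSum F x).2 v hv
  have h4 : v (chartMu F x : V) = v (chartMoment F x) := rfl
  simp only [map_add, map_smul, smul_eq_mul] at h1
  simp only [Submodule.coe_add, Submodule.coe_smul_of_tower, map_add, map_nsmul, nsmul_eq_mul]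
  rw [div_lt_iff₀ hδ] at hN
  have h5 : 0 ≤ δ * (N * v (supportSum F x : M) + v m) := by nlinarith
  exact nonneg_of_mul_nonneg_right h5 hδ

/-- The characters that do not vanish at `x` are those parallel to the smallest face through the
moment of `x`. -/
theorem chi_ne_zero_iff {F : P.Face} {x : F.Chart} {m : F.dualMonoid} :
    x.chi m ≠ 0 ↔ (m : M) ∈ (faceAt (chartMu F x)).lattice := by
  constructor
  · intro hx
    obtain ⟨c, hc, hcF, hsum⟩ := F.exists_conic m
    rw [Face.mem_lattice, hsum]
    refine Submodule.sum_mem _ fun i _ => ?_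
    by_cases hi : c i = 0
    · simp [hi]
    refine Submodule.smul_mem _ _ (vsub_mem_vectorSpan ℝ ?_
      (subset_faceAt_chartMu F x (hcF i hi)))
    refine mem_faceAt_of_normWeight_ne_zero (normWeight_ne_zero.2 ?_)
    -- a multiple of `m` dominates the term `u - f` of its conic representation
    obtain ⟨N, hN⟩ := exists_nat_gt (1 / c i)
    have hci : 0 < c i := lt_of_le_of_ne (hc i) (Ne.symm hi)
    rw [div_lt_iff₀ hci] at hN
    let d : F.dualMonoid := ⟨i.1.1 - i.2.1, sub_mem F i.1.2 (hcF i hi)⟩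
    have hd : N • (m : M) - d ∈ F.dualMonoid := by
      intro v hv
      have hterm : ∀ j, 0 ≤ c j * (v j.1.vec - v j.2.vec) := fun j => by
        by_cases hj : c j = 0
        · simp [hj]
        · exact mul_nonneg (hc j) (sub_nonneg.2 (hv _ (hcF j hj) _ j.1.vec_mem))
      have h1 : c i * (v i.1.vec - v i.2.vec) ≤ v (m : M) := by
        rw [hsum]
        simp only [map_sum, map_smul, map_sub, smul_eq_mul]
        exact Finset.single_le_sum (fun j _ => hterm j) (Finset.mem_univ i)
      have h2 : 0 ≤ v i.1.vec - v i.2.vec := sub_nonneg.2 (hv _ (hcF i hi) _ i.1.vec_mem)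
      have h3 : v ((d : M) : V) = v i.1.vec - v i.2.vec := by simp [d, LatticePoint.vec]
      simp only [Submodule.coe_sub, Submodule.coe_smul_of_tower, map_sub, map_nsmul, nsmul_eq_mul,
        h3]
      have h4 : (N : ℝ) * (c i * (v i.1.vec - v i.2.vec)) ≤ N * v (m : M) :=
        mul_le_mul_of_nonneg_left h1 (Nat.cast_nonneg N)
      nlinarith
    have hxd : x.chi d ≠ 0 := by
      have : x.chi (N • m) = x.chi d * x.chi ⟨_, hd⟩ := by
        rw [← AffinePoints.chi_add]
        congr 1
        apply Subtype.ext
        simp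
      rw [AffinePoints.chi_nsmul] at this
      exact left_ne_zero_of_mul (this ▸ pow_ne_zero N hx)
    have hf : x.chi ⟨i.2.1 - F.base, sub_mem F i.2.2 F.base_mem⟩ ≠ 0 :=
      Face.chi_ne_zero_of_mem_lattice x (F.sub_mem_lattice (hcF i hi) F.base_mem)
    have : x.chi ⟨i.1.1 - F.base, sub_mem F i.1.2 F.base_mem⟩ =
        x.chi d * x.chi ⟨i.2.1 - F.base, sub_mem F i.2.2 F.base_mem⟩ := by
      rw [← AffinePoints.chi_add]
      congr 1
      apply Subtype.ext
      simp [d]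
    rw [this]
    exact mul_ne_zero hxd hf
  · intro hm
    obtain ⟨N, hN⟩ := exists_nsmul_add_mem F x (neg_mem hm)
    have : x.chi (N • supportSum F x) = x.chi m * x.chi ⟨_, hN⟩ := by
      rw [← AffinePoints.chi_add]
      congr 1
      apply Subtype.ext
      simp
    rw [AffinePoints.chi_nsmul] at this
    exact left_ne_zero_of_mul (this ▸ pow_ne_zero N (chi_supportSum_ne_zero F x))

/-- The character of `M_K` given by a point `x` of a chart that lies in the orbit of `σ_K`. -/
theorem exists_character (F : P.Face) (x : F.Chart) :
    ∃ g : Multiplicative (faceAt (chartMu F x)).lattice →* ℝˣ,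
      ∀ (m : F.dualMonoid) (hm : (m : M) ∈ (faceAt (chartMu F x)).lattice),
        (g (Multiplicative.ofAdd ⟨m, hm⟩) : ℝ) = x.chi m := by
  set L := (faceAt (chartMu F x)).lattice with hL
  set e := supportSum F x with he
  have he0 : x.chi e ≠ 0 := chi_supportSum_ne_zero F x
  choose N hN using fun m : L => exists_nsmul_add_mem F x m.2
  let y : L → ℝ := fun m => x.chi ⟨_, hN m⟩ / x.chi e ^ N m
  have hy : ∀ (m : L) (n : ℕ) (h : n • (e : M) + m ∈ F.dualMonoid),
      y m * x.chi e ^ n = x.chi ⟨_, h⟩ := by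
    intro m n h
    have : x.chi ⟨_, hN m⟩ * x.chi e ^ n = x.chi ⟨_, h⟩ * x.chi e ^ N m := by
      rw [← AffinePoints.chi_nsmul, ← AffinePoints.chi_nsmul, ← AffinePoints.chi_add,
        ← AffinePoints.chi_add]
      congr 1
      apply Subtype.ext
      simp only [AddSubmonoid.coe_add, AddSubmonoidClass.coe_nsmul]
      abel
    simp only [y]
    rw [div_mul_eq_mul_div, this, mul_div_assoc, div_self (pow_ne_zero _ he0), mul_one]
  have hy1 : ∀ (m : F.dualMonoid) (hm : (m : M) ∈ L), y ⟨m, hm⟩ = x.chi m := by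
    intro m hm
    have h : 0 • (e : M) + m ∈ F.dualMonoid := by simp
    have := hy ⟨m, hm⟩ 0 h
    rw [pow_zero, mul_one] at this
    rw [this]
    congr 1
    apply Subtype.ext
    simp
  have hyadd : ∀ m m' : L, y (m + m') = y m * y m' := by
    intro m m'
    have h : (N m + N m') • (e : M) + ((m + m' : L) : M) ∈ F.dualMonoid := by
      have := add_mem (hN m) (hN m')
      convert this using 1
      rw [add_nsmul, AddSubgroup.coe_add]
      abel
    have h1 := hy (m + m') _ h
    have h2 : x.chi ⟨_, h⟩ = x.chi ⟨_, hN m⟩ * x.chi ⟨_, hN m'⟩ := by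
      rw [← AffinePoints.chi_add]
      congr 1
      apply Subtype.ext
      simp only [AddSubmonoid.coe_add, AddSubgroup.coe_add, add_nsmul]
      abel
    rw [h2, ← hy m _ (hN m), ← hy m' _ (hN m'), pow_add] at h1
    have h3 : x.chi e ^ N m * x.chi e ^ N m' ≠ 0 :=
      mul_ne_zero (pow_ne_zero _ he0) (pow_ne_zero _ he0)
    refine mul_right_cancel₀ h3 (h1.trans ?_)
    ring
  let g₀ : Multiplicative L →* ℝ :=
    { toFun := fun m => y m.toAdd
      map_one' := by
        refine (hy1 0 (zero_mem L)).trans x.chi_zero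
      map_mul' := fun m m' => hyadd _ _ }
  exact ⟨g₀.toHomUnits, hy1⟩

/-- Every real point of a chart lies in the torus orbit of the smallest face that contains its
image under the moment map. -/
theorem exists_eq_incl_orbitPoint [IsZLattice ℝ M] (F : P.Face) (x : F.Chart) :
    ∃ (ε : SignChar M) (v : Module.Dual ℝ V),
      x = Face.incl (subset_faceAt_chartMu F x) ((faceAt (chartMu F x)).orbitPoint ε v) := by
  obtain ⟨g, hg⟩ := exists_character F x
  obtain ⟨ε, v, h⟩ := (faceAt (chartMu F x)).exists_sign_dual g
  refine ⟨ε, v, AffinePoints.ext_chi fun m => ?_⟩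
  rw [Face.chi_incl]
  by_cases hm : (m : M) ∈ (faceAt (chartMu F x)).lattice
  · rw [Face.chi_orbitPoint hm, ← hg m hm, h]
  · rw [Face.chi_orbitPoint_of_notMem hm]
    by_contra h0
    exact hm (chi_ne_zero_iff.1 h0)

/-! ### Weight vectors of points of the toric variety -/

/-- The weight vectors that satisfy all binomial equations `∏ λ_u ^ a_u = ∏ λ_u ^ b_u` with real
exponents, for vectors `a` and `b` with the same total and the same moment. -/
def toricWeights (P : LatticePolytope M) : Set (P.LatticePoint → ℝ) :=
  {w | w ∈ stdSimplex ℝ P.LatticePoint ∧ ∀ a b : P.LatticePoint → ℝ, (∀ u, 0 ≤ a u) →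
    (∀ u, 0 ≤ b u) → ∑ u, a u = ∑ u, b u → ∑ u, a u • u.vec = ∑ u, b u • u.vec →
      ∏ u, w u ^ a u = ∏ u, w u ^ b u}

theorem isCompact_toricWeights (P : LatticePolytope M) : IsCompact P.toricWeights := by
  refine (isCompact_stdSimplex ℝ P.LatticePoint).inter_right
    (t := {w | ∀ a b : P.LatticePoint → ℝ, (∀ u, 0 ≤ a u) → (∀ u, 0 ≤ b u) →
      ∑ u, a u = ∑ u, b u → ∑ u, a u • u.vec = ∑ u, b u • u.vec →
        ∏ u, w u ^ a u = ∏ u, w u ^ b u}) ?_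
  simp only [Set.ofPred_forall]
  refine isClosed_iInter fun a => isClosed_iInter fun b => isClosed_iInter fun ha =>
    isClosed_iInter fun hb => isClosed_iInter fun _ => isClosed_iInter fun _ => ?_
  exact isClosed_eq
    (continuous_finsetProd _ fun u _ => (continuous_apply u).rpow_const fun _ => Or.inr (ha u))
    (continuous_finsetProd _ fun u _ => (continuous_apply u).rpow_const fun _ => Or.inr (hb u))

/-- Applying the binomial equations of `w` to the exponent vectors `w` and `w'` themselves compares
the logarithms of the weights. -/
theorem toricWeights_support_and_log {w w' : P.LatticePoint → ℝ} (hw : w ∈ P.toricWeights)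
    (hw' : w' ∈ stdSimplex ℝ P.LatticePoint)
    (h : ∑ u, w u • u.vec = ∑ u, w' u • u.vec) :
    (∀ u, w u = 0 → w' u = 0) ∧ ∑ u, w u * Real.log (w u) = ∑ u, w' u * Real.log (w u) := by
  have hprod := hw.2 w w' hw.1.1 hw'.1 (hw.1.2.trans hw'.2.symm) h
  have hne : ∀ u, w u ^ w u ≠ 0 := fun u => by
    by_cases hu : w u = 0
    · simp [hu]
    · exact (Real.rpow_pos_of_pos (lt_of_le_of_ne (hw.1.1 u) (Ne.symm hu)) _).ne'
  have hne' : ∀ u, w u ^ w' u ≠ 0 := fun u => by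
    have : ∏ u, w u ^ w' u ≠ 0 := hprod ▸ Finset.prod_ne_zero_iff.2 fun u _ => hne u
    exact Finset.prod_ne_zero_iff.1 this u (Finset.mem_univ u)
  have h0 : ∀ u, w u = 0 → w' u = 0 := fun u hu => by
    by_contra hu'
    exact hne' u (by rw [hu, Real.zero_rpow hu'])
  refine ⟨h0, ?_⟩
  have hlog := congrArg Real.log hprod
  rw [Real.log_prod (fun u _ => hne u), Real.log_prod (fun u _ => hne' u)] at hlog
  have key : ∀ u t, (w u = 0 → t = 0) → Real.log (w u ^ t) = t * Real.log (w u) := fun u t ht => by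
    by_cases hu : w u = 0
    · simp [hu, ht hu]
    · exact Real.log_rpow (lt_of_le_of_ne (hw.1.1 u) (Ne.symm hu)) t
  simpa only [key _ _ (fun hu => hu), key _ _ (h0 _)] using hlog

/-- A toric weight vector is determined by its moment, because the logarithm is strictly
monotone. -/
theorem toricWeights_injective {w w' : P.LatticePoint → ℝ} (hw : w ∈ P.toricWeights)
    (hw' : w' ∈ P.toricWeights) (h : ∑ u, w u • u.vec = ∑ u, w' u • u.vec) : w = w' := by
  obtain ⟨h1, h2⟩ := toricWeights_support_and_log hw hw'.1 h
  obtain ⟨h1', h2'⟩ := toricWeights_support_and_log hw' hw.1 h.symm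
  have hsum : ∑ u, (w u - w' u) * (Real.log (w u) - Real.log (w' u)) = 0 := by
    simp only [mul_sub, sub_mul, Finset.sum_sub_distrib]
    linarith
  have hpos : ∀ u, w u ≠ 0 → 0 < w u ∧ 0 < w' u := fun u hu =>
    ⟨lt_of_le_of_ne (hw.1.1 u) (Ne.symm hu),
      lt_of_le_of_ne (hw'.1.1 u) (Ne.symm fun h => hu (h1' u h))⟩
  have hnn : ∀ u, 0 ≤ (w u - w' u) * (Real.log (w u) - Real.log (w' u)) := fun u => by
    by_cases hu : w u = 0
    · simp [hu, h1 u hu]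
    · obtain ⟨hp, hp'⟩ := hpos u hu
      rcases le_total (w u) (w' u) with hle | hle
      · exact mul_nonneg_of_nonpos_of_nonpos (sub_nonpos.2 hle)
          (sub_nonpos.2 (Real.log_le_log hp hle))
      · exact mul_nonneg (sub_nonneg.2 hle) (sub_nonneg.2 (Real.log_le_log hp' hle))
  funext u
  by_cases hu : w u = 0
  · rw [hu, h1 u hu]
  · obtain ⟨hp, hp'⟩ := hpos u hu
    have hz := (Finset.sum_eq_zero_iff_of_nonneg fun u _ => hnn u).1 hsum u (Finset.mem_univ u)
    rcases mul_eq_zero.1 hz with h | h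
    · exact sub_eq_zero.1 h
    · exact Real.log_injOn_pos hp hp' (sub_eq_zero.1 h)

/-- The exponents of two sides of a binomial equation are both supported on a face, or neither
is. -/
theorem support_subset_face {a b : P.LatticePoint → ℝ} (K : P.Face)
    (hb : ∀ u, 0 ≤ b u) (h1 : ∑ u, a u = ∑ u, b u)
    (h2 : ∑ u, a u • u.vec = ∑ u, b u • u.vec) (h : ∀ u, a u ≠ 0 → u.vec ∈ K.carrier) :
    ∀ u, b u ≠ 0 → u.vec ∈ K.carrier := by
  obtain ⟨l, hl, hK⟩ := K.exists_functional
  have hmul : ∀ c : P.LatticePoint → ℝ,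
      ∑ u, c u * (l u.vec - l K.base) = l (∑ u, c u • u.vec) - (∑ u, c u) * l K.base := fun c => by
    simp [mul_sub, Finset.sum_sub_distrib, Finset.sum_mul]
  have ha0 : ∑ u, a u * (l u.vec - l K.base) = 0 := Finset.sum_eq_zero fun u _ => by
    by_cases hu : a u = 0
    · simp [hu]
    · rw [le_antisymm (hl _ (h u hu) _ (K.subset K.base_mem)) (hl _ K.base_mem _ u.vec_mem),
        sub_self, mul_zero]
  have hb0 : ∑ u, b u * (l u.vec - l K.base) = 0 := by
    rw [hmul, ← h1, ← h2, ← hmul, ha0]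
  intro u hu
  have hz := (Finset.sum_eq_zero_iff_of_nonneg fun u _ => mul_nonneg (hb u)
    (sub_nonneg.2 (hl _ K.base_mem _ u.vec_mem))).1 hb0 u (Finset.mem_univ u)
  have := (mul_eq_zero.1 hz).resolve_left hu
  exact hK _ K.base_mem _ u.vec_mem (by linarith)

/-- Weights that are exponential in `u` on a face, and vanish off it, satisfy the binomial
equations. -/
theorem mem_toricWeights_of_exp {w : P.LatticePoint → ℝ} (hw : w ∈ stdSimplex ℝ P.LatticePoint)
    (K : P.Face) (v : Module.Dual ℝ V) (C : ℝ) (hC : 0 < C)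
    (hK : ∀ u : P.LatticePoint, u.vec ∈ K.carrier → w u = C * Real.exp (v u.vec))
    (hK' : ∀ u : P.LatticePoint, u.vec ∉ K.carrier → w u = 0) : w ∈ P.toricWeights := by
  refine ⟨hw, fun a b ha hb h1 h2 => ?_⟩
  have hzero : ∀ c : P.LatticePoint → ℝ, (¬ ∀ u, c u ≠ 0 → u.vec ∈ K.carrier) →
      ∏ u, w u ^ c u = 0 := fun c hc => by
    push Not at hc
    obtain ⟨u, hu, huK⟩ := hc
    exact Finset.prod_eq_zero (Finset.mem_univ u) (by rw [hK' u huK, Real.zero_rpow hu])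
  have hexp : ∀ c : P.LatticePoint → ℝ, (∀ u, c u ≠ 0 → u.vec ∈ K.carrier) →
      ∏ u, w u ^ c u = Real.exp ((∑ u, c u) * Real.log C + v (∑ u, c u • u.vec)) := fun c hc => by
    have : (∑ u, c u) * Real.log C + v (∑ u, c u • u.vec) =
        ∑ u, c u * (Real.log C + v u.vec) := by
      simp [mul_add, Finset.sum_add_distrib, Finset.sum_mul]
    rw [this, Real.exp_sum]
    refine Finset.prod_congr rfl fun u _ => ?_
    by_cases hu : c u = 0
    · simp [hu]
    · have h0 : w u = Real.exp (Real.log C + v u.vec) := by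
        rw [hK u (hc u hu), Real.exp_add, Real.exp_log hC]
      rw [h0, ← Real.exp_mul, mul_comm]
  by_cases h : ∀ u, a u ≠ 0 → u.vec ∈ K.carrier
  · rw [hexp a h, hexp b (support_subset_face K hb h1 h2 h), h1, h2]
  · rw [hzero a h, hzero b fun h' => h (support_subset_face K ha h1.symm h2.symm h')]

end Finite

namespace Face

variable {F G : P.Face}

theorem incl_rfl (x : F.Chart) : incl (Set.Subset.refl F.carrier) x = x :=
  AffinePoints.ext_chi fun m => chi_incl _ x m

theorem sub_mem_lattice_iff {u u₀ : M} (hu : (u : V) ∈ P.carrier) (hu₀ : (u₀ : V) ∈ F.carrier) :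
    u - u₀ ∈ F.lattice ↔ (u : V) ∈ F.carrier := by
  refine ⟨fun h => ?_, fun h => F.sub_mem_lattice h hu₀⟩
  obtain ⟨l, hl, hF⟩ := F.exists_functional
  have := normalCone_eq_zero hl h
  rw [Submodule.coe_sub, map_sub, sub_eq_zero] at this
  exact hF _ hu₀ _ hu this.le

end Face

section Finite

variable [FiniteDimensional ℝ V] [DiscreteTopology M]

/-- The weights of a point `ε · exp v` of the orbit of `σ_K` are proportional to `exp (v u)` on the
lattice points of `K`, and vanish on all others. -/
theorem normWeight_incl_orbitPoint {F K : P.Face} (h : F.carrier ⊆ K.carrier) (ε : SignChar M)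
    (v : Module.Dual ℝ V) : ∃ C : ℝ, 0 < C ∧
      (∀ u : P.LatticePoint, u.vec ∈ K.carrier →
        normWeight F (Face.incl h (K.orbitPoint ε v)) u = C * Real.exp (v u.vec)) ∧
      ∀ u : P.LatticePoint, u.vec ∉ K.carrier →
        normWeight F (Face.incl h (K.orbitPoint ε v)) u = 0 := by
  set x := Face.incl h (K.orbitPoint ε v)
  refine ⟨(∑ w, weight F x w)⁻¹ * Real.exp (-v F.base),
    mul_pos (inv_pos.2 (sum_weight_pos F x)) (Real.exp_pos _), fun u hu => ?_, fun u hu => ?_⟩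
  · have hm := (Face.sub_mem_lattice_iff u.2 (h F.base_mem)).2 hu
    rw [normWeight, weight, Face.chi_incl, Face.chi_orbitPoint hm, abs_mul, SignChar.abs_val,
      one_mul, Real.abs_exp, mul_assoc, ← Real.exp_add]
    congr 2
    simp only [Submodule.coe_sub, map_sub, LatticePoint.vec]
    ring
  · have hm := fun h' => hu ((Face.sub_mem_lattice_iff u.2 (h F.base_mem)).1 h')
    rw [normWeight, weight, Face.chi_incl, Face.chi_orbitPoint_of_notMem hm, abs_zero, mul_zero]

theorem normWeight_mem_stdSimplex (F : P.Face) (x : F.Chart) :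
    normWeight F x ∈ stdSimplex ℝ P.LatticePoint :=
  ⟨normWeight_nonneg F x, sum_normWeight F x⟩

theorem normWeight_mem_toricWeights [IsZLattice ℝ M] (F : P.Face) (x : F.Chart) :
    normWeight F x ∈ P.toricWeights := by
  obtain ⟨ε, v, hx⟩ := exists_eq_incl_orbitPoint F x
  obtain ⟨C, hC, h1, h2⟩ := normWeight_incl_orbitPoint (subset_faceAt_chartMu F x) ε v
  rw [← hx] at h1 h2
  exact mem_toricWeights_of_exp (normWeight_mem_stdSimplex F x) _ v C hC h1 h2

/-- The coefficients of a representation of `m` as a nonnegative combination of differences `u - f`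
of lattice points with `f` in `F`. -/
noncomputable def conicCoeff (F : P.Face) (m : F.dualMonoid) :
    P.LatticePoint × P.LatticePoint → ℝ := (F.exists_conic m).choose

theorem conicCoeff_nonneg (F : P.Face) (m : F.dualMonoid) (i : P.LatticePoint × P.LatticePoint) :
    0 ≤ conicCoeff F m i := (F.exists_conic m).choose_spec.1 i

theorem mem_of_conicCoeff_ne_zero {F : P.Face} {m : F.dualMonoid}
    {i : P.LatticePoint × P.LatticePoint} (hi : conicCoeff F m i ≠ 0) : i.2.vec ∈ F.carrier :=
  (F.exists_conic m).choose_spec.2.1 i hi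

theorem sum_conicCoeff (F : P.Face) (m : F.dualMonoid) :
    ((m : M) : V) = ∑ i, conicCoeff F m i • (i.1.vec - i.2.vec) :=
  (F.exists_conic m).choose_spec.2.2

/-- The absolute value of a character, as a function of the weights: a product of ratios of weights
whose denominators belong to lattice points of `F`. -/
noncomputable def absChar (F : P.Face) (m : F.dualMonoid) (w : P.LatticePoint → ℝ) : ℝ :=
  ∏ i : P.LatticePoint × P.LatticePoint, (w i.1 / w i.2) ^ conicCoeff F m i

theorem continuousAt_absChar (F : P.Face) (m : F.dualMonoid) {w : P.LatticePoint → ℝ}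
    (hw : ∀ u : P.LatticePoint, u.vec ∈ F.carrier → w u ≠ 0) :
    ContinuousAt (absChar F m) w := by
  refine tendsto_finsetProd _ fun i _ => ?_
  by_cases hi : conicCoeff F m i = 0
  · simp only [hi, Real.rpow_zero]
    exact tendsto_const_nhds
  · refine Filter.Tendsto.rpow_const ?_ (Or.inr (conicCoeff_nonneg F m i))
    exact ((continuous_apply i.1).tendsto w).div ((continuous_apply i.2).tendsto w)
      (hw _ (mem_of_conicCoeff_ne_zero hi))

/-- If `m` is not parallel to the face of the orbit of `x`, both sides vanish: some weight `λ_u` in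
the product is zero and occurs with a positive exponent. -/
theorem abs_chi_eq_absChar [IsZLattice ℝ M] (F : P.Face) (x : F.Chart) (m : F.dualMonoid) :
    |x.chi m| = absChar F m (normWeight F x) := by
  obtain ⟨ε, v, hx⟩ := exists_eq_incl_orbitPoint F x
  have hFK := subset_faceAt_chartMu F x
  obtain ⟨C, hC, h1, h2⟩ := normWeight_incl_orbitPoint hFK ε v
  rw [← hx] at h1 h2
  set K := faceAt (chartMu F x) with hK
  have hsum := sum_conicCoeff F m
  by_cases hm : (m : M) ∈ K.lattice
  · have hchi : |x.chi m| = Real.exp (v (m : M)) := by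
      conv_lhs => rw [hx]
      rw [Face.chi_incl, Face.chi_orbitPoint hm, abs_mul, SignChar.abs_val, one_mul, Real.abs_exp]
    obtain ⟨l, hl, hlK⟩ := K.exists_functional
    have hl0 : ∑ i, conicCoeff F m i * (l i.1.vec - l i.2.vec) = 0 := by
      rw [← Face.normalCone_eq_zero hl hm, hsum]
      simp
    have hz := (Finset.sum_eq_zero_iff_of_nonneg fun i _ => by
      by_cases hi : conicCoeff F m i = 0
      · simp [hi]
      · exact mul_nonneg (conicCoeff_nonneg F m i) (sub_nonneg.2
          (hl _ (hFK (mem_of_conicCoeff_ne_zero hi)) _ i.1.vec_mem))).1 hl0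
    rw [hchi, absChar, hsum, map_sum, Real.exp_sum]
    refine Finset.prod_congr rfl fun i hi => ?_
    by_cases hc : conicCoeff F m i = 0
    · simp [hc]
    have h3 := hFK (mem_of_conicCoeff_ne_zero hc)
    have h4 : i.1.vec ∈ K.carrier := by
      refine hlK _ h3 _ i.1.vec_mem ?_
      have := (mul_eq_zero.1 (hz i hi)).resolve_left hc
      linarith
    rw [h1 _ h3, h1 _ h4, mul_div_mul_left _ _ hC.ne', ← Real.exp_sub, ← Real.exp_mul, map_smul,
      map_sub, smul_eq_mul, mul_comm]
  · have hchi : x.chi m = 0 := by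
      by_contra h
      exact hm (chi_ne_zero_iff.1 h)
    obtain ⟨i, hi, hiK⟩ : ∃ i, conicCoeff F m i ≠ 0 ∧ i.1.vec ∉ K.carrier := by
      by_contra! hcon
      refine hm ?_
      rw [Face.mem_lattice, hsum]
      refine Submodule.sum_mem _ fun i _ => ?_
      by_cases hc : conicCoeff F m i = 0
      · simp [hc]
      · exact Submodule.smul_mem _ _ (vsub_mem_vectorSpan ℝ (hcon i hc)
          (hFK (mem_of_conicCoeff_ne_zero hc)))
    rw [hchi, abs_zero, absChar, Finset.prod_eq_zero (Finset.mem_univ i)]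
    rw [h2 _ hiK, zero_div, Real.zero_rpow hi]

/-! ### Surjectivity of the moment map -/

open Classical in
/-- The gradient of `v ↦ ∑ exp (v (u - p))`, summed over the lattice points `u` of the smallest
face through `p`, vanishes at some functional `v`: the sum attains its minimum because `p` lies in
the relative interior of that face. -/
theorem exists_critical (p : P.carrier) : ∃ v : Module.Dual ℝ V,
    ∑ u : P.LatticePoint, (if u.vec ∈ (faceAt p).carrier then Real.exp (v (u.vec - p)) else 0) •
      (u.vec - (p : V)) = 0 := by
  set K := faceAt p with hK
  let U := {u : P.LatticePoint // u.vec ∈ K.carrier}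
  let T : Module.Dual ℝ V →ₗ[ℝ] (U → ℝ) :=
    LinearMap.pi fun u => Module.Dual.eval ℝ V (u.1.vec - (p : V))
  have hT : ∀ v (u : U), T v u = v (u.1.vec - (p : V)) := fun v u => rfl
  let φ : (U → ℝ) → ℝ := fun y => ∑ u, Real.exp (y u)
  have hφ : Continuous φ := by fun_prop
  let S : Set (U → ℝ) := (LinearMap.range T : Set (U → ℝ)) ∩ {y | φ y ≤ φ 0}
  have hSc : IsClosed S :=
    (Submodule.closed_of_finiteDimensional _).inter (isClosed_le hφ continuous_const)
  set B := Real.log (φ 0) with hB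
  have hup : ∀ y ∈ S, ∀ u, y u ≤ B := fun y hy u => by
    have h1 : Real.exp (y u) ≤ φ 0 := (Finset.single_le_sum (f := fun u => Real.exp (y u))
      (fun w _ => (Real.exp_pos _).le) (Finset.mem_univ u)).trans hy.2
    exact (Real.le_log_iff_exp_le ((Real.exp_pos _).trans_le h1)).2 h1
  have hlow : ∀ u : U, ∃ A : ℝ, ∀ y ∈ S, A ≤ y u := fun u => by
    obtain ⟨δ, hδ, hq⟩ := (exists_faceAt p).choose_spec.2 u.1.vec u.2
    refine ⟨-(B / δ), ?_⟩
    rintro y ⟨⟨v, rfl⟩, hy⟩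
    set q := (p : V) + δ • ((p : V) - u.1.vec) with hqdef
    have hqK : q ∈ K.carrier := by
      refine K.mem_of_segment u.1.vec_mem hq (a := (1 + δ)⁻¹ * δ) (b := (1 + δ)⁻¹)
        (by positivity) (by positivity) (by field_simp; ring) ?_ (mem_faceAt p)
      rw [mul_smul, ← smul_add]
      have : δ • u.1.vec + q = (1 + δ) • (p : V) := by
        rw [hqdef, smul_sub, add_smul, one_smul]; abel
      rw [this, smul_smul, inv_mul_cancel₀ (by positivity), one_smul]
    obtain ⟨β, h0, h1, hβ⟩ := exists_weights hq
    have hle : v (q - p) ≤ B := by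
      have h3 : v (q - p) = ∑ w, β w * v (w.vec - (p : V)) := by
        rw [← hβ]
        simp [mul_sub, Finset.sum_sub_distrib, ← Finset.sum_mul, h1]
      rw [h3, ← one_mul B, ← h1, Finset.sum_mul]
      refine Finset.sum_le_sum fun w _ => ?_
      by_cases hw : β w = 0
      · simp [hw]
      · have hwK : w.vec ∈ K.carrier := K.mem_of_weights h0 h1 (hβ ▸ hqK) hw
        exact mul_le_mul_of_nonneg_left (hup _ ⟨⟨v, rfl⟩, hy⟩ ⟨w, hwK⟩) (h0 w)
    have h4 : v (q - p) = -(δ * T v u) := by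
      rw [hqdef, hT, add_sub_cancel_left, map_smul, smul_eq_mul, ← mul_neg, ← map_neg, neg_sub]
    rw [h4] at hle
    rw [← neg_div, div_le_iff₀ hδ]
    linarith
  choose A hA using hlow
  have hS : IsCompact S := (isCompact_univ_pi fun u => isCompact_Icc (a := A u)
    (b := B)).of_isClosed_subset hSc fun y hy u _ => ⟨hA u y hy, hup y hy u⟩
  obtain ⟨y, hy, hmin⟩ := hS.exists_isMinOn ⟨0, zero_mem _, le_refl (φ 0)⟩ hφ.continuousOn
  obtain ⟨⟨v, rfl⟩, hvle⟩ := hy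
  have hmin' : ∀ w, φ (T v) ≤ φ (T w) := fun w => by
    rcases le_total (φ (T w)) (φ 0) with h | h
    · exact hmin ⟨⟨w, rfl⟩, h⟩
    · exact le_trans hvle h
  refine ⟨v, (Module.forall_dual_apply_eq_zero_iff ℝ _).1 fun w => ?_⟩
  have hd : HasDerivAt (fun t : ℝ => φ (T (v + t • w)))
      (∑ u : U, Real.exp (T v u) * T w u) 0 := by
    have : ∀ u : U, HasDerivAt (fun t : ℝ => Real.exp (T (v + t • w) u))
        (Real.exp (T v u) * T w u) 0 := fun u => by
      have h1 : HasDerivAt (fun t : ℝ => T v u + t * T w u) (T w u) 0 := by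
        simpa using ((hasDerivAt_id (0 : ℝ)).mul_const (T w u)).const_add (T v u)
      have h2 := h1.exp
      simp only [zero_mul, add_zero] at h2
      convert h2 using 1
      funext t
      simp
    exact HasDerivAt.fun_sum fun u _ => this u
  have hloc : IsLocalMin (fun t : ℝ => φ (T (v + t • w))) 0 :=
    Filter.Eventually.of_forall fun t => by
      simpa using hmin' (v + t • w)
  have hzero := hloc.hasDerivAt_eq_zero hd
  rw [map_sum]
  simp only [map_smul, smul_eq_mul, ite_mul, zero_mul]
  rw [← Finset.sum_filter, Finset.sum_subtype _ (p := fun u => u.vec ∈ K.carrier) (by simp)]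
  exact hzero

theorem exists_chartMoment_eq (p : P.carrier) : ∃ v : Module.Dual ℝ V, ∀ ε : SignChar M,
    chartMoment (faceAt p) ((faceAt p).orbitPoint ε v) = p := by
  classical
  obtain ⟨v, hv⟩ := exists_critical p
  refine ⟨v, fun ε => ?_⟩
  obtain ⟨C, hC, h1, h2⟩ :=
    normWeight_incl_orbitPoint (Set.Subset.refl (faceAt p).carrier) ε v
  rw [Face.incl_rfl] at h1 h2
  set x := (faceAt p).orbitPoint ε v
  have h : ∑ u, normWeight (faceAt p) x u • (u.vec - (p : V)) = 0 := by
    rw [← smul_zero (C * Real.exp (v p)), ← hv, Finset.smul_sum]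
    refine Finset.sum_congr rfl fun u _ => ?_
    rw [smul_smul]
    congr 1
    by_cases hu : u.vec ∈ (faceAt p).carrier
    · rw [if_pos hu, h1 u hu, map_sub, mul_assoc, ← Real.exp_add, add_sub_cancel]
    · rw [if_neg hu, h2 u hu, mul_zero]
  simp only [smul_sub, Finset.sum_sub_distrib, ← Finset.sum_smul, sum_normWeight, one_smul] at h
  rw [← sum_normWeight_smul]
  exact sub_eq_zero.1 h

end Finite

/-! ### The sign of a real point -/

/-- The real point of `X_P` given by a point of a chart. -/
def ofChart (F : P.Face) (x : F.Chart) : P.RealPoints := Quot.mk P.Glue ⟨F, x⟩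

theorem continuous_ofChart (F : P.Face) : Continuous (ofChart F) :=
  continuous_quot_mk.comp continuous_sigmaMk

theorem ofChart_incl {F G : P.Face} (h : F.carrier ⊆ G.carrier) (z : G.Chart) :
    ofChart F (Face.incl h z) = ofChart G z :=
  Quot.sound ⟨G, h, Set.Subset.refl _, z, rfl, Face.incl_rfl z⟩

/-- The values of all characters at `x` are zero or have the sign prescribed by `ε`. -/
def HasSign (ε : SignChar M) {F : P.Face} (x : F.Chart) : Prop :=
  ∀ m, x.chi m = ε.val m * |x.chi m|

theorem isClosed_hasSign (ε : SignChar M) (F : P.Face) :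
    IsClosed {x : F.Chart | HasSign ε x} := by
  simp only [HasSign, Set.ofPred_forall]
  exact isClosed_iInter fun m => isClosed_eq (AffinePoints.continuous_chi m)
    (continuous_const.mul (AffinePoints.continuous_chi m).abs)

theorem Face.Agree.mono {F G : P.Face} {ε ε' : SignChar M} (h : F.carrier ⊆ G.carrier)
    (hG : G.Agree ε ε') : F.Agree ε ε' :=
  fun u hu => hG u (Face.lattice_mono h hu)

section Finite

variable [FiniteDimensional ℝ V] [DiscreteTopology M]

theorem hasSign_orbitPoint (F : P.Face) (ε : SignChar M) (v : Module.Dual ℝ V) :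
    HasSign ε (F.orbitPoint ε v) := by
  intro m
  by_cases hm : (m : M) ∈ F.lattice
  · rw [Face.chi_orbitPoint hm, abs_mul, SignChar.abs_val, one_mul, Real.abs_exp]
  · rw [Face.chi_orbitPoint_of_notMem hm, abs_zero, mul_zero]

theorem Face.agree_of_hasSign_orbitPoint {F : P.Face} {ε ε' : SignChar M} {v : Module.Dual ℝ V}
    (h : HasSign ε' (F.orbitPoint ε v)) : F.Agree ε ε' := by
  intro m hm
  have := h ⟨m, Face.lattice_le_dualMonoid hm⟩
  rw [Face.chi_orbitPoint hm, abs_mul, SignChar.abs_val, one_mul, Real.abs_exp] at this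
  exact SignChar.val_inj.1 (mul_right_cancel₀ (Real.exp_pos _).ne' this)

theorem Face.orbitPoint_congr {F : P.Face} {ε ε' : SignChar M} (h : F.Agree ε ε')
    (v : Module.Dual ℝ V) : F.orbitPoint ε v = F.orbitPoint ε' v := by
  refine AffinePoints.ext_chi fun m => ?_
  by_cases hm : (m : M) ∈ F.lattice
  · rw [Face.chi_orbitPoint hm, Face.chi_orbitPoint hm, SignChar.val_inj.2 (h _ hm)]
  · rw [Face.chi_orbitPoint_of_notMem hm, Face.chi_orbitPoint_of_notMem hm]

/-- The monoid of the chart of a larger face arises by inverting elements that become units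
there. -/
theorem Face.exists_add_mem_dualMonoid {F G : P.Face} (h : F.carrier ⊆ G.carrier)
    (m : G.dualMonoid) :
    ∃ b : M, b ∈ F.dualMonoid ∧ b ∈ G.lattice ∧ (m : M) + b ∈ F.dualMonoid := by
  classical
  let s := Finset.univ.filter fun u : P.LatticePoint => u.vec ∈ G.carrier
  let c : M := ∑ u ∈ s, (u.1 - F.base)
  have hcG : c ∈ G.lattice := sum_mem fun u hu =>
    G.sub_mem_lattice (Finset.mem_filter.1 hu).2 (h F.base_mem)
  have hvc : ∀ v : Module.Dual ℝ V, v (c : V) = ∑ u ∈ s, (v u.vec - v F.base) := fun v => by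
    simp [c, LatticePoint.vec]
  have hnn : ∀ v ∈ F.normalCone, ∀ u : P.LatticePoint, 0 ≤ v u.vec - v F.base := fun v hv u =>
    sub_nonneg.2 (hv _ F.base_mem _ u.vec_mem)
  have hcF : c ∈ F.dualMonoid := sum_mem fun u _ => sub_mem F u.2 F.base_mem
  obtain ⟨N, hN⟩ := exists_nat_ge (∑ i, conicCoeff G m i)
  refine ⟨N • c, nsmul_mem hcF N, nsmul_mem hcG N, fun v hv => ?_⟩
  have h1 : -((∑ i, conicCoeff G m i) * v (c : V)) ≤ v (m : M) := by
    rw [sum_conicCoeff G m, map_sum, Finset.sum_mul, ← Finset.sum_neg_distrib]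
    refine Finset.sum_le_sum fun i _ => ?_
    rw [map_smul, smul_eq_mul, ← mul_neg]
    by_cases hi : conicCoeff G m i = 0
    · simp [hi]
    refine mul_le_mul_of_nonneg_left ?_ (conicCoeff_nonneg G m i)
    have h2 : v i.2.vec - v F.base ≤ v (c : V) := by
      rw [hvc]
      exact Finset.single_le_sum (f := fun u : P.LatticePoint => v u.vec - v F.base)
        (fun u _ => hnn v hv u)
        (Finset.mem_filter.2 ⟨Finset.mem_univ _, mem_of_conicCoeff_ne_zero hi⟩)
    have h3 := hnn v hv i.1
    rw [map_sub]
    linarith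
  have h4 : (∑ i, conicCoeff G m i) * v (c : V) ≤ N * v (c : V) :=
    mul_le_mul_of_nonneg_right hN (hcF v hv)
  simp only [Submodule.coe_add, Submodule.coe_smul_of_tower, map_add, map_nsmul, nsmul_eq_mul]
  linarith

theorem hasSign_incl {F G : P.Face} (h : F.carrier ⊆ G.carrier) (ε : SignChar M) (z : G.Chart) :
    HasSign ε (Face.incl h z) ↔ HasSign ε z := by
  refine ⟨fun hz m => ?_, fun hz m => ?_⟩
  · obtain ⟨b, hb, hbG, hmb⟩ := Face.exists_add_mem_dualMonoid h m
    have hb' : z.chi ⟨b, Face.dualMonoid_mono h hb⟩ =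
        ε.val b * |z.chi ⟨b, Face.dualMonoid_mono h hb⟩| := by
      simpa only [Face.chi_incl] using hz ⟨b, hb⟩
    have hmb' : z.chi ⟨m + b, Face.dualMonoid_mono h hmb⟩ =
        ε.val (m + b) * |z.chi ⟨m + b, Face.dualMonoid_mono h hmb⟩| := by
      simpa only [Face.chi_incl] using hz ⟨m + b, hmb⟩
    have hne : z.chi ⟨b, Face.dualMonoid_mono h hb⟩ ≠ 0 :=
      Face.chi_ne_zero_of_mem_lattice z hbG
    have hadd : z.chi ⟨m + b, Face.dualMonoid_mono h hmb⟩ =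
        z.chi m * z.chi ⟨b, Face.dualMonoid_mono h hb⟩ := by
      rw [← AffinePoints.chi_add]
      rfl
    rw [hadd, SignChar.val_add, abs_mul, mul_mul_mul_comm, ← hb'] at hmb'
    exact mul_right_cancel₀ hne hmb'
  · rw [Face.chi_incl]
    exact hz _

/-- The real points of `X_P` at which all characters vanish or have the sign prescribed by `ε`. -/
def signSet (P : LatticePolytope M) (ε : SignChar M) : Set P.RealPoints :=
  {x | Quot.lift (fun x : Σ F : P.Face, F.Chart => HasSign ε x.2) (by
    rintro x y ⟨G, hx, hy, z, h, h'⟩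
    rw [← h, ← h']
    exact propext ((hasSign_incl hx ε z).trans (hasSign_incl hy ε z).symm)) x}

theorem ofChart_mem_signSet {ε : SignChar M} {F : P.Face} {x : F.Chart} :
    ofChart F x ∈ P.signSet ε ↔ HasSign ε x := Iff.rfl

theorem isClosed_signSet (P : LatticePolytope M) (ε : SignChar M) : IsClosed (P.signSet ε) := by
  refine isClosed_coinduced.2 (isClosed_sigma_iff.2 fun F => ?_)
  exact isClosed_hasSign ε F

theorem exists_hasSign [IsZLattice ℝ M] {F : P.Face} (x : F.Chart) :
    ∃ ε : SignChar M, HasSign ε x := by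
  obtain ⟨ε, v, hx⟩ := exists_eq_incl_orbitPoint F x
  rw [hx]
  exact ⟨ε, (hasSign_incl _ ε _).2 (hasSign_orbitPoint _ ε v)⟩

/-! ### The section of the moment map with given signs -/

/-- A functional `v` such that `exp v`, on the orbit of the smallest face through `p`, is mapped
to `p` by the moment map. -/
noncomputable def potential (p : P.carrier) : Module.Dual ℝ V := (exists_chartMoment_eq p).choose

/-- The point with signs `ε` and moment `p`, in the chart of the smallest face through `p`. -/
noncomputable def sectionChart (ε : SignChar M) (p : P.carrier) : (faceAt p).Chart :=
  (faceAt p).orbitPoint ε (potential p)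

theorem chartMu_sectionChart (ε : SignChar M) (p : P.carrier) :
    chartMu (faceAt p) (sectionChart ε p) = p :=
  Subtype.ext ((exists_chartMoment_eq p).choose_spec ε)

theorem hasSign_sectionChart (ε : SignChar M) (p : P.carrier) : HasSign ε (sectionChart ε p) :=
  hasSign_orbitPoint _ ε _

/-- The point of `X_P(ℝ)` with signs `ε` and moment `p`. -/
noncomputable def sectionPoint (ε : SignChar M) (p : P.carrier) : P.RealPoints :=
  ofChart (faceAt p) (sectionChart ε p)

theorem sectionPoint_mem (ε : SignChar M) (p : P.carrier) : sectionPoint ε p ∈ P.signSet ε :=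
  hasSign_sectionChart ε p

theorem momentMap_sectionPoint (ε : SignChar M) (p : P.carrier) :
    P.momentMap (sectionPoint ε p) = p :=
  chartMu_sectionChart ε p

theorem sectionPoint_congr {ε ε' : SignChar M} {p : P.carrier} (h : (faceAt p).Agree ε ε') :
    sectionPoint ε p = sectionPoint ε' p := by
  rw [sectionPoint, sectionPoint, sectionChart, sectionChart, Face.orbitPoint_congr h]

theorem agree_of_sectionPoint_mem {ε ε' : SignChar M} {p : P.carrier}
    (h : sectionPoint ε p ∈ P.signSet ε') : (faceAt p).Agree ε ε' :=
  Face.agree_of_hasSign_orbitPoint (ofChart_mem_signSet.1 h)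

/-- The normalised weights of the points with moment `p`. -/
noncomputable def weightAt (p : P.carrier) : P.LatticePoint → ℝ :=
  normWeight (faceAt p) (sectionChart 1 p)

variable [IsZLattice ℝ M]

theorem normWeight_eq_weightAt (F : P.Face) (x : F.Chart) :
    normWeight F x = weightAt (chartMu F x) := by
  refine toricWeights_injective (normWeight_mem_toricWeights F x)
    (normWeight_mem_toricWeights _ _) ?_
  rw [sum_normWeight_smul, weightAt, sum_normWeight_smul]
  exact (congrArg Subtype.val (chartMu_sectionChart 1 (chartMu F x))).symm

/-- The weights depend continuously on the moment, as the inverse of a continuous bijection from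
the compact space of toric weight vectors onto the polytope. -/
theorem continuous_weightAt : Continuous (weightAt (P := P)) := by
  let f : P.toricWeights → P.carrier := fun w =>
    ⟨∑ u, w.1 u • u.vec, sum_mem_carrier w.2.1.1 w.2.1.2⟩
  let g : P.carrier → P.toricWeights := fun p => ⟨weightAt p, normWeight_mem_toricWeights _ _⟩
  have hfg : ∀ p, f (g p) = p := fun p => Subtype.ext <|
    (sum_normWeight_smul _ _).trans (congrArg Subtype.val (chartMu_sectionChart 1 p))
  let e : P.toricWeights ≃ P.carrier :=
    { toFun := f
      invFun := g
      left_inv := fun w => Subtype.ext (toricWeights_injective (g (f w)).2 w.2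
        (congrArg Subtype.val (hfg (f w))))
      right_inv := hfg }
  have hf : Continuous e := by
    refine Continuous.subtype_mk ?_ _
    exact continuous_finsetSum _ fun u _ =>
      ((continuous_apply u).comp continuous_subtype_val).smul continuous_const
  have : CompactSpace P.toricWeights := isCompact_iff_compactSpace.1 (isCompact_toricWeights P)
  exact continuous_subtype_val.comp (Continuous.homeoOfEquivCompactToT2 (f := e) hf).symm.continuous

theorem HasSign.chi_eq {ε : SignChar M} {F : P.Face} {x : F.Chart} (hx : HasSign ε x)
    (m : F.dualMonoid) : x.chi m = ε.val m * absChar F m (weightAt (chartMu F x)) := by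
  rw [← normWeight_eq_weightAt, ← abs_chi_eq_absChar]
  exact hx m

/-- A real point is determined by its signs and its moment. -/
theorem HasSign.ofChart_eq {ε : SignChar M} {F : P.Face} {x : F.Chart} (hx : HasSign ε x) :
    ofChart F x = sectionPoint ε (chartMu F x) := by
  obtain ⟨ε', v, h⟩ := exists_eq_incl_orbitPoint F x
  set K := faceAt (chartMu F x) with hK
  have hz : HasSign ε (K.orbitPoint ε' v) := by
    rw [h] at hx
    exact (hasSign_incl _ ε _).1 hx
  have hmu : chartMu K (K.orbitPoint ε' v) = chartMu F x := by
    conv_rhs => rw [h]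
    rw [chartMu_incl]
  have heq : K.orbitPoint ε' v = sectionChart ε (chartMu F x) := by
    refine AffinePoints.ext_chi fun m => ?_
    rw [hz.chi_eq, (hasSign_sectionChart ε (chartMu F x)).chi_eq, chartMu_sectionChart, hmu]
  rw [sectionPoint, ← heq]
  conv_lhs => rw [h]
  exact ofChart_incl _ _

theorem eq_sectionPoint {ε : SignChar M} {x : P.RealPoints} (hx : x ∈ P.signSet ε) :
    x = sectionPoint ε (P.momentMap x) := by
  obtain ⟨⟨F, x⟩, rfl⟩ := Quot.exists_rep x
  exact HasSign.ofChart_eq (ofChart_mem_signSet.1 hx)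

theorem continuous_sectionPoint (ε : SignChar M) :
    Continuous fun p : P.carrier => sectionPoint ε p := by
  classical
  rw [continuous_iff_continuousAt]
  intro p
  set F := faceAt p with hF
  have hne : ∀ u : P.LatticePoint, u.vec ∈ F.carrier → weightAt p u ≠ 0 := fun u hu =>
    normWeight_ne_zero_of_mem hu
  -- near `p` the weights of the lattice points of `F` remain nonzero
  have hev : ∀ᶠ q in nhds p, F.carrier ⊆ (faceAt q).carrier := by
    have : ∀ᶠ q in nhds p, ∀ u : P.LatticePoint, u.vec ∈ F.carrier → weightAt q u ≠ 0 := by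
      refine Filter.eventually_all.2 fun u => ?_
      by_cases hu : u.vec ∈ F.carrier
      · have hc : ContinuousAt (fun q : P.carrier => weightAt q u) p :=
          ((continuous_apply u).comp continuous_weightAt).continuousAt
        filter_upwards [hc.eventually_ne (hne u hu)] with q hq _ using hq
      · exact Filter.Eventually.of_forall fun q h => absurd h hu
    filter_upwards [this] with q hq
    refine Face.subset_of_latticePoint fun u hu => ?_
    have := mem_faceAt_of_normWeight_ne_zero (hq u hu)
    rwa [chartMu_sectionChart] at this
  let y : P.carrier → F.Chart := fun q =>
    if h : F.carrier ⊆ (faceAt q).carrier then Face.incl h (sectionChart ε q) else sectionChart ε p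
  have hy : Filter.Tendsto y (nhds p) (nhds (sectionChart ε p)) := by
    refine AffinePoints.tendsto_nhds fun m => ?_
    rw [(hasSign_sectionChart ε p).chi_eq, chartMu_sectionChart]
    have hlim : Filter.Tendsto (fun q : P.carrier => ε.val m * absChar F m (weightAt q)) (nhds p)
        (nhds (ε.val m * absChar F m (weightAt p))) :=
      ((continuousAt_absChar F m hne).tendsto.comp
        continuous_weightAt.continuousAt.tendsto).const_mul _
    refine hlim.congr' ?_
    filter_upwards [hev] with q hq
    simp only [y]
    rw [dif_pos hq, ((hasSign_incl hq ε _).2 (hasSign_sectionChart ε q)).chi_eq, chartMu_incl,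
      chartMu_sectionChart]
  refine Filter.Tendsto.congr' ?_ (((continuous_ofChart F).tendsto _).comp hy)
  filter_upwards [hev] with q hq
  simp only [y, Function.comp_apply]
  rw [dif_pos hq, ofChart_incl, sectionPoint]

end Finite

/-! ### The closures of the components of the real torus -/

/-- The point of the torus with coordinates `ε · exp v`. -/
noncomputable def torusPoint (ε : SignChar M) (v : Module.Dual ℝ V) : AffinePoints M :=
  AffinePoints.ofChar
    { toFun := fun m => ε.val m.toAdd * Real.exp (v (m.toAdd : M))
      map_one' := by simp [SignChar.val_zero]
      map_mul' := fun m m' => by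
        simp only [toAdd_mul, SignChar.val_add, Submodule.coe_add, map_add, Real.exp_add]
        ring }

theorem chi_torusPoint (ε : SignChar M) (v : Module.Dual ℝ V) (m : M) :
    (torusPoint ε v).chi m = ε.val m * Real.exp (v m) :=
  AffinePoints.chi_ofChar _ m

theorem torusIncl_torusPoint_mem (P : LatticePolytope M) (ε : SignChar M) (v : Module.Dual ℝ V) :
    P.torusIncl (torusPoint ε v) ∈ P.torusPart ε := by
  refine ⟨_, fun u => ?_, rfl⟩
  have h : (((SignType.sign ((torusPoint ε v).chi u) : SignType) : ℤ) : ℝ) = ε.val u := by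
    rw [SignType.intCast_cast, chi_torusPoint, sign_mul, sign_pos (Real.exp_pos _), mul_one]
    rcases ε.val_eq u with h | h <;> simp [h]
  exact Int.cast_injective (α := ℝ) h

variable [FiniteDimensional ℝ V] [DiscreteTopology M]

theorem torusPart_subset_signSet (P : LatticePolytope M) (ε : SignChar M) :
    P.torusPart ε ⊆ P.signSet ε := by
  rintro _ ⟨t, ht, rfl⟩
  refine ofChart_mem_signSet.2 fun m => ?_
  rw [AffinePoints.chi_comap]
  change t.chi (m : M) = ε.val m * |t.chi (m : M)|
  have h : ((SignType.sign (t.chi (m : M)) : SignType) : ℝ) = ε.val m := by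
    rw [SignChar.val, ← ht (m : M), SignType.intCast_cast]
  rw [← h]
  exact (sign_mul_abs _).symm

/-- A point of a torus orbit is the limit of points of the torus with the same signs, along a
one-parameter subgroup in the relative interior of the cone. -/
theorem ofChart_orbitPoint_mem_closure (F : P.Face) (ε : SignChar M) (v : Module.Dual ℝ V) :
    ofChart F (F.orbitPoint ε v) ∈ closure (P.torusPart ε) := by
  obtain ⟨l, hl, hF⟩ := F.exists_functional
  have htop : F.carrier ⊆ P.top.carrier := F.subset
  let y : ℕ → F.Chart := fun n => Face.incl htop
    ((torusPoint ε (v - (n : ℝ) • l)).comap P.top.dualMonoid.subtype)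
  have hychi : ∀ (m : F.dualMonoid) (n : ℕ),
      (y n).chi m = ε.val m * Real.exp (v (m : M)) * Real.exp (-l (m : M)) ^ n := fun m n => by
    simp only [y]
    rw [Face.chi_incl, AffinePoints.chi_comap, chi_torusPoint, mul_assoc, ← Real.exp_nat_mul,
      ← Real.exp_add]
    congr 2
    simp
    ring
  have hy : Filter.Tendsto y Filter.atTop (nhds (F.orbitPoint ε v)) := by
    refine AffinePoints.tendsto_nhds fun m => ?_
    simp only [hychi]
    by_cases hm : (m : M) ∈ F.lattice
    · rw [Face.chi_orbitPoint hm]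
      simp only [Face.normalCone_eq_zero hl hm, neg_zero, Real.exp_zero, one_pow, mul_one]
      exact tendsto_const_nhds
    · rw [Face.chi_orbitPoint_of_notMem hm]
      have hpos : 0 < l (m : M) := by
        by_contra h
        exact hm (Face.mem_lattice_of_functional hl hF m.2 (not_lt.1 h))
      have := (tendsto_pow_atTop_nhds_zero_of_lt_one (Real.exp_pos (-l (m : M))).le
        (by rw [Real.exp_lt_one_iff]; linarith)).const_mul (ε.val m * Real.exp (v (m : M)))
      rwa [mul_zero] at this
  refine mem_closure_of_tendsto (((continuous_ofChart F).tendsto _).comp hy)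
    (Filter.Eventually.of_forall fun n => ?_)
  simp only [Function.comp_apply, y, ofChart_incl]
  exact torusIncl_torusPoint_mem P ε _

/-- The closure `X_ε` of `T_ε` consists of the real points whose signs are compatible with `ε`. -/
theorem signPart_eq_signSet [IsZLattice ℝ M] (P : LatticePolytope M) (ε : SignChar M) :
    P.signPart ε = P.signSet ε := by
  refine Set.Subset.antisymm
    (closure_minimal (torusPart_subset_signSet P ε) (isClosed_signSet P ε)) fun x hx => ?_
  rw [eq_sectionPoint hx]
  exact ofChart_orbitPoint_mem_closure _ ε _

/-! ### Gluing -/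

theorem continuous_chartMu (F : P.Face) : Continuous (chartMu F) := by
  have hw : ∀ u : P.LatticePoint, Continuous fun x : F.Chart => weight F x u := fun u =>
    (AffinePoints.continuous_chi _).abs
  refine Continuous.subtype_mk ?_ _
  exact ((continuous_finsetSum _ fun u _ => hw u).inv₀ fun x => (sum_weight_pos F x).ne').smul
    (continuous_finsetSum _ fun u _ => (hw u).smul continuous_const)

theorem agree_iff_of_gluedSpace_mk (F : P.Face) (ε ε' : SignChar M) :
    (∀ p : P.carrier, (p : V) ∈ F.carrier → GluedSpace.mk P ε p = GluedSpace.mk P ε' p) ↔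
      F.Agree ε ε' := by
  classical
  refine ⟨fun h => ?_, fun h p hp => Quotient.sound ⟨rfl, F, hp, h⟩⟩
  -- the barycentre of the lattice points of `F` lies in no smaller face
  let s := Finset.univ.filter fun u : P.LatticePoint => u.vec ∈ F.carrier
  have hs : s.Nonempty :=
    ⟨⟨F.base, F.subset F.base_mem⟩, Finset.mem_filter.2 ⟨Finset.mem_univ _, F.base_mem⟩⟩
  have hcard : (0 : ℝ) < s.card := Nat.cast_pos.2 hs.card_pos
  let β : P.LatticePoint → ℝ := fun u => if u ∈ s then (s.card : ℝ)⁻¹ else 0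
  have h0 : ∀ u, 0 ≤ β u := fun u => by
    simp only [β]
    split_ifs
    · exact (inv_pos.2 hcard).le
    · exact le_rfl
  have h1 : ∑ u, β u = 1 := by
    simp only [β, Finset.sum_ite_mem, Finset.univ_inter, Finset.sum_const, nsmul_eq_mul]
    exact mul_inv_cancel₀ hcard.ne'
  have hpF : ∑ u, β u • u.vec ∈ F.carrier := by
    have : ∑ u, β u • u.vec = ∑ u ∈ s, (s.card : ℝ)⁻¹ • u.vec := by
      simp only [β, ite_smul, zero_smul, Finset.sum_ite_mem, Finset.univ_inter]
    rw [this]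
    refine F.convex.sum_mem (fun _ _ => (inv_pos.2 hcard).le) ?_
      fun u hu => (Finset.mem_filter.1 hu).2
    rw [Finset.sum_const, nsmul_eq_mul]
    exact mul_inv_cancel₀ hcard.ne'
  obtain ⟨-, G, hG, hag⟩ := Quotient.exact (h ⟨_, F.subset hpF⟩ hpF)
  refine Face.Agree.mono (Face.subset_of_latticePoint fun u hu => ?_) hag
  refine G.mem_of_weights h0 h1 hG ?_
  have hus : u ∈ s := Finset.mem_filter.2 ⟨Finset.mem_univ _, hu⟩
  simp only [β, if_pos hus]
  exact (inv_pos.2 hcard).ne'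

/-- The map from the glued space to `X_P(ℝ)` that sends the copy `P_ε` to `X_ε` by the section of
the moment map. -/
noncomputable def ofGlued (P : LatticePolytope M) : P.GluedSpace → P.RealPoints :=
  Quotient.lift (fun a : Σ _ : SignChar M, P.carrier => sectionPoint a.1 a.2) (by
    rintro ⟨ε, p⟩ ⟨ε', p'⟩ ⟨h, F, hF, hag⟩
    obtain rfl : p = p' := h
    exact sectionPoint_congr (hag.mono (faceAt_subset hF)))

theorem ofGlued_mk (ε : SignChar M) (p : P.carrier) :
    ofGlued P (GluedSpace.mk P ε p) = sectionPoint ε p := rfl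

variable [IsZLattice ℝ M]

theorem card_signChar (M : Submodule ℤ V) [DiscreteTopology M] [IsZLattice ℝ M] :
    Nat.card (SignChar M) = 2 ^ Module.finrank ℤ M := by
  have : Module.Free ℤ M := ZLattice.module_free ℝ M
  have : Module.Finite ℤ M := ZLattice.module_finite ℝ M
  let b := Module.Free.chooseBasis ℤ M
  let e : SignChar M ≃ (Module.Free.ChooseBasisIndex ℤ M → Additive ℤˣ) :=
    (MonoidHom.toAdditiveRight.trans (addMonoidHomLequivInt ℤ).toEquiv).trans
      (b.constr ℤ).symm.toEquiv
  have h2 : Nat.card (Additive ℤˣ) = 2 := by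
    rw [Nat.card_congr Additive.toMul, Nat.card_eq_fintype_card]
    rfl
  rw [Nat.card_congr e, Nat.card_fun, h2, Module.finrank_eq_card_basis b, Nat.card_eq_fintype_card]

instance finite_signChar : Finite (SignChar M) :=
  Nat.finite_of_card_ne_zero (by rw [card_signChar]; positivity)

theorem continuous_ofGlued (P : LatticePolytope M) : Continuous (ofGlued P) :=
  Continuous.quotient_lift (continuous_sigma fun ε => continuous_sectionPoint ε) _

theorem ofGlued_bijective (P : LatticePolytope M) : Function.Bijective (ofGlued P) := by
  constructor
  · intro a b
    induction a using Quotient.inductionOn with | _ a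
    induction b using Quotient.inductionOn with | _ b
    obtain ⟨ε, p⟩ := a
    obtain ⟨ε', p'⟩ := b
    intro h
    have h' : sectionPoint ε p = sectionPoint ε' p' := h
    obtain rfl : p = p' := by
      rw [← momentMap_sectionPoint ε p, h', momentMap_sectionPoint]
    exact Quotient.sound ⟨rfl, faceAt p, mem_faceAt p,
      agree_of_sectionPoint_mem (h' ▸ sectionPoint_mem ε' p)⟩
  · intro x
    obtain ⟨⟨F, x⟩, rfl⟩ := Quot.exists_rep x
    obtain ⟨ε, hx⟩ := exists_hasSign x
    exact ⟨GluedSpace.mk P ε (chartMu F x), (ofGlued_mk _ _).trans hx.ofChart_eq.symm⟩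

/-- The inverse is continuous because every chart is covered by finitely many closed sets, on each
of which the signs are constant and the inverse is given by the moment map. -/
noncomputable def gluedHomeomorph (P : LatticePolytope M) : P.GluedSpace ≃ₜ P.RealPoints where
  toEquiv := Equiv.ofBijective _ (ofGlued_bijective P)
  continuous_toFun := continuous_ofGlued P
  continuous_invFun := by
    set e := Equiv.ofBijective _ (ofGlued_bijective P) with he
    refine continuous_coinduced_dom.2 (continuous_sigma fun F => ?_)
    refine (locallyFinite_of_finite fun ε : SignChar M => {x : F.Chart | HasSign ε x}).continuous
      ?_ (fun ε => isClosed_hasSign ε F) fun ε => ?_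
    · exact Set.eq_univ_of_forall fun x => Set.mem_iUnion.2 (exists_hasSign x)
    · have hc : Continuous fun x : F.Chart => GluedSpace.mk P ε (chartMu F x) :=
        continuous_quot_mk.comp (continuous_sigmaMk.comp (continuous_chartMu F))
      refine hc.continuousOn.congr fun x hx => ?_
      exact e.symm_apply_eq.2 (HasSign.ofChart_eq hx)

theorem signPart_inter (P : LatticePolytope M) (ε ε' : SignChar M) :
    P.signPart ε ∩ P.signPart ε' = ⋃ (F : P.Face) (_ : F.Agree ε ε'),
      Subtype.val '' (P.signMomentMap ε ⁻¹' {p | (p : V) ∈ F.carrier}) := by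
  ext x
  simp only [Set.mem_iUnion, Set.mem_inter_iff]
  constructor
  · rintro ⟨hx, hx'⟩
    refine ⟨faceAt (P.momentMap x), ?_, ⟨x, hx⟩, mem_faceAt (P.momentMap x), rfl⟩
    rw [signPart_eq_signSet] at hx hx'
    rw [eq_sectionPoint hx] at hx'
    exact agree_of_sectionPoint_mem hx'
  · rintro ⟨F, hag, ⟨y, hy⟩, hyF, rfl⟩
    refine ⟨hy, ?_⟩
    have hyF' : (P.momentMap y : V) ∈ F.carrier := hyF
    rw [signPart_eq_signSet] at hy ⊢
    change y ∈ _
    rw [eq_sectionPoint hy, sectionPoint_congr (hag.mono (faceAt_subset hyF'))]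
    exact sectionPoint_mem ε' _

end LatticePolytope
end RealToric

theorem mainTheorem2 {V : Type*} [NormedAddCommGroup V] [NormedSpace ℝ V] [FiniteDimensional ℝ V]
    (M : Submodule ℤ V) [DiscreteTopology M] [IsZLattice ℝ M]
    (P : RealToric.LatticePolytope M) :
    -- the intersections of the parts of `X_P(ℝ)`
    (∀ ε ε' : RealToric.SignChar M,
      P.signPart ε ∩ P.signPart ε' =
        ⋃ (F : P.Face) (_ : F.Agree ε ε'),
          Subtype.val '' (P.signMomentMap ε ⁻¹' {p | (p : V) ∈ F.carrier})) ∧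
    -- `X_P(ℝ)` is glued from `2 ^ rank M` copies of `P`, through the maps `μ_ε`
    Nat.card (RealToric.SignChar M) = 2 ^ Module.finrank ℤ M ∧
    (∃ h : P.GluedSpace ≃ₜ P.RealPoints, ∀ (ε : RealToric.SignChar M) (p : P.carrier),
      ∃ hx : h (RealToric.LatticePolytope.GluedSpace.mk P ε p) ∈ P.signPart ε,
        P.signMomentMap ε ⟨h (RealToric.LatticePolytope.GluedSpace.mk P ε p), hx⟩ = p) ∧
    -- the faces `F_ε` and `F_ε'` are identified exactly when `ε` and `ε'` agree on `M_F`
    (∀ (F : P.Face) (ε ε' : RealToric.SignChar M),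
      (∀ p : P.carrier, (p : V) ∈ F.carrier →
        RealToric.LatticePolytope.GluedSpace.mk P ε p =
          RealToric.LatticePolytope.GluedSpace.mk P ε' p) ↔ F.Agree ε ε') := by
  refine ⟨P.signPart_inter, RealToric.LatticePolytope.card_signChar M,
    ⟨P.gluedHomeomorph, fun ε p => ?_⟩, RealToric.LatticePolytope.agree_iff_of_gluedSpace_mk⟩
  refine ⟨?_, RealToric.LatticePolytope.momentMap_sectionPoint ε p⟩
  rw [RealToric.LatticePolytope.signPart_eq_signSet]
  exact RealToric.LatticePolytope.sectionPoint_mem ε p
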